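/- Let $\mathbb D$ be the open unit disc, $dm = r\,dr\,d\theta/\pi$ the normalized area measure on $\mathbb D$, and $\varphi_a(z)=\frac{a-z}{1-\bar a z}$ for $a\in\mathbb D$. For $1\le p<\infty$, $f$ analytic on $\mathbb D$ and $a\in\mathbb D$ put $$I_p(f,a)=\int_{\mathbb D}|f'(z)|^p(1-|z|^2)^{p-2}(1-|\varphi_a(z)|^2)\,dm(z).$$ Let $BMOA_p$ be the space of analytic $f$ on $\mathbb D$ with $\sup_{a\in\mathbb D}I_p(f,a)<\infty$, normed by $\|f\|_{BMOA_p}=\bigl(|f(0)|^p+\sup_{a\in\mathbb D}I_p(f,a)\bigr)^{1/p}$, and let $VMOA_p$ be the subspace, with the same norm, of those $f\in BMOA_p$ with $\lim_{|a|\to1}I_p(f,a)=0$. **Theorem.** Let $1\le p<2$. There is a constant $C>0$ depending only on $p$ such that for every univalent (that is, injective) analytic function $\psi:\mathbb D\to\mathbb D$ the following hold. 1. The composition operator $C_\psi f=f\circ\psi$ maps $BMOA_p$ into $BMOA_p$, is bounded there, and $$\|C_\psi\|_{BMOA_p\to BMOA_p}\le C\left(1+\log\frac{1+|\psi(0)|}{1-|\psi(0)|}\right).$$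 2. $C_\psi$ maps $VMOA_p$ into $VMOA_p$ and is bounded there. -/

import Mathlib

open Filter Topology MeasureTheory
open scoped ENNReal

namespace CompBMOA

/-- The open unit disc of the complex plane. -/
def disc : Set ℂ := Metric.ball 0 1

/-- The Möbius automorphism `z ↦ (a - z) / (1 - conj a * z)` of the disc, for `a` in the disc. -/
noncomputable def mobius (a z : ℂ) : ℂ := (a - z) / (1 - (starRingEnd ℂ) a * z)

/-- Normalized Lebesgue area measure of the disc, `r dr dθ / π`. -/
noncomputable def area : Measure ℂ := ENNReal.ofReal (1 / Real.pi) • volume.restrict disc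

/-- `∫_𝔻 |f'(z)|^p (1 - |z|²)^(p-2) (1 - |φ_a(z)|²) dm(z)`, as a number in `[0, ∞]`. -/
noncomputable def bmoaIntegral (p : ℝ) (f : ℂ → ℂ) (a : ℂ) : ℝ≥0∞ :=
  ∫⁻ z, ‖deriv f z‖ₑ ^ p *
    ENNReal.ofReal ((1 - ‖z‖ ^ 2) ^ (p - 2) * (1 - ‖mobius a z‖ ^ 2)) ∂area

/-- The `BMOA_p` norm, with the value `∞` allowed:
`‖f‖^p = |f(0)|^p + sup_{a ∈ 𝔻} ∫_𝔻 |f'(z)|^p (1 - |z|²)^(p-2) (1 - |φ_a(z)|²) dm(z)`. -/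
noncomputable def bmoaNorm (p : ℝ) (f : ℂ → ℂ) : ℝ≥0∞ :=
  (‖f 0‖ₑ ^ p + ⨆ a ∈ disc, bmoaIntegral p f a) ^ (1 / p)

/-- `BMOA_p`: the functions analytic on the disc whose integrals have a finite supremum. Values of
`f` outside the disc play no role. -/
def BMOA (p : ℝ) : Set (ℂ → ℂ) :=
  {f | DifferentiableOn ℂ f disc ∧ ⨆ a ∈ disc, bmoaIntegral p f a < ∞}

/-- `VMOA_p`: the functions of `BMOA_p` whose integrals tend to `0` as `|a| → 1` in the disc. -/
def VMOA (p : ℝ) : Set (ℂ → ℂ) :=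
  {f | f ∈ BMOA p ∧ Tendsto (bmoaIntegral p f) (comap norm (𝓝[<] (1 : ℝ))) (𝓝 0)}

/-- The composition operator `C_ψ f = f ∘ ψ`. -/
def compOp (ψ f : ℂ → ℂ) : ℂ → ℂ := fun z => f (ψ z)

/-- The operator norm of `C_ψ` on a space `S` (of functions of finite `BMOA_p` norm), with respect
to the `BMOA_p` norm: the infimum of the `M` with `‖C_ψ f‖ ≤ M ‖f‖` for all `f ∈ S`, which is `∞`
when no finite `M` works. -/
noncomputable def compOpNorm (p : ℝ) (S : Set (ℂ → ℂ)) (ψ : ℂ → ℂ) : ℝ≥0∞ :=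
  sInf {M : ℝ≥0∞ | ∀ f ∈ S, bmoaNorm p (compOp ψ f) ≤ M * bmoaNorm p f}

end CompBMOA

namespace CompBMOA

/-! ### Polar coordinates and mean values -/

/-! The proof rests on Möbius invariance. Substituting `φ_a` turns `I_p(f,a)` into `D_p(f ∘ φ_a)/π`,
where `D_p(F) = ∫ |F'|^p (1-|z|²)^(p-1)`. Since `φ_{ψ(a)}` is an involution, `f ∘ ψ ∘ φ_a = (f ∘
φ_{ψ(a)}) ∘ χ` with `χ = φ_{ψ(a)} ∘ ψ ∘ φ_a` univalent and `χ(0) = 0`. So `I_p(f ∘ ψ, a) ≤ C I_p(f,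
ψ(a))` follows from `D_p(F ∘ χ) ≤ C D_p(F)` for univalent `χ` fixing `0`.

For the latter (`lintegral_comp_weight_le`), `|F'(χ(z))|^p` is bounded by its mean over the disc of
radius `(1-|χ(z)|)/2` about `χ(z)`, and the integrals are swapped. What remains is `∫_E |χ'|^p
(1-|z|²)^(p-1) ≤ C l^(p+1)`, where `l = 1-|ζ|` and `E` is the set mapped close to `ζ`. On `E`
Schwarz's lemma gives `1-|z| < 2l`, and `|χ'|^p ≤ 1 + |χ'|²` leaves two areas of order `l²`: that of
`χ(E)`, by univalence, and that of `E`, by a harmonic measure estimate (`volume_nearPreimage_le`).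

The logarithm comes only from `f(ψ(0))`: functions in `BMOA_p` satisfy a Bloch estimate, hence grow
at most logarithmically.

For `VMOA_p`, the inequality settles the points with `|ψ(a)|` near `1`. If `|ψ(a)| ≤ ρ` and `|a| →
1`, the integral is split at `1-|χ(z)| = t`. The part near the circle is a tail of the convergent
integral `D_p(f)`, uniformly in `ψ(a)`; on the rest `F'` is bounded, which leaves a multiple of
`I_p(ψ,a)`. That tends to `0` because bounded univalent functions have finite area
(`exists_bmoaIntegral_selfMap_le`). -/

theorem lintegral_annulus_eq_polar {F : ℂ → ℝ≥0∞} (hF : Measurable F) {s R : ℝ} (hs : 0 ≤ s) :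
    ∫⁻ z in {z : ℂ | s < ‖z‖ ∧ ‖z‖ < R}, F z =
      ∫⁻ r in Set.Ioo s R, ENNReal.ofReal r *
        ∫⁻ θ in Set.Ioo (-Real.pi) Real.pi, F (circleMap 0 r θ) := by
  have hA : MeasurableSet {z : ℂ | s < ‖z‖ ∧ ‖z‖ < R} :=
    (measurableSet_lt measurable_const measurable_norm).inter
      (measurableSet_lt measurable_norm measurable_const)
  have hcirc : Measurable fun q : ℝ × ℝ => circleMap 0 q.1 q.2 := by
    unfold circleMap; fun_prop
  rw [← lintegral_indicator hA, ← Complex.lintegral_comp_polarCoord_symm]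
  have hsymm : ∀ q : ℝ × ℝ, Complex.polarCoord.symm q = circleMap 0 q.1 q.2 := by
    intro q
    rw [Complex.polarCoord_symm_apply, circleMap, Complex.exp_mul_I]
    push_cast; ring
  have h1 : ∀ q ∈ polarCoord.target,
      ENNReal.ofReal q.1 • ({z : ℂ | s < ‖z‖ ∧ ‖z‖ < R}.indicator F (Complex.polarCoord.symm q)) =
      (Set.Ioo s R ×ˢ Set.univ).indicator
        (fun q : ℝ × ℝ => ENNReal.ofReal q.1 * F (circleMap 0 q.1 q.2)) q := by
    intro q hq
    have hq1 : 0 < q.1 := hq.1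
    rw [hsymm]
    by_cases h : s < q.1 ∧ q.1 < R
    · rw [Set.indicator_of_mem, Set.indicator_of_mem]
      · rfl
      · exact ⟨h, trivial⟩
      · simpa [abs_of_pos hq1] using h
    · rw [Set.indicator_of_notMem, Set.indicator_of_notMem]
      · simp
      · rintro ⟨h', -⟩; exact h h'
      · simpa [abs_of_pos hq1] using h
  rw [setLIntegral_congr_fun polarCoord.open_target.measurableSet h1,
    lintegral_indicator (measurableSet_Ioo.prod MeasurableSet.univ),
    Measure.restrict_restrict (measurableSet_Ioo.prod MeasurableSet.univ)]
  have h2 : (Set.Ioo s R ×ˢ Set.univ) ∩ polarCoord.target =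
      Set.Ioo s R ×ˢ Set.Ioo (-Real.pi) Real.pi := by
    ext q
    simp only [polarCoord_target, Set.mem_inter_iff, Set.mem_prod, Set.mem_Ioo, Set.mem_univ,
      Set.mem_Ioi]
    constructor
    · tauto
    · rintro ⟨h, h'⟩; exact ⟨⟨h, trivial⟩, lt_of_le_of_lt hs h.1, h'⟩
  rw [h2, Measure.volume_eq_prod, setLIntegral_prod]
  · refine setLIntegral_congr_fun measurableSet_Ioo fun r _ => ?_
    simp only
    rw [lintegral_const_mul]
    exact hF.comp (hcirc.comp (measurable_const.prodMk measurable_id))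
  · exact ((measurable_fst.ennreal_ofReal).mul (hF.comp hcirc)).aemeasurable

theorem integral_circleMap_eq {g : ℂ → ℂ} {c : ℂ} {R : ℝ} (hg : DiffContOnCl ℂ g (Metric.ball c |R|)) :
    ∫ θ in (-Real.pi)..Real.pi, g (circleMap c R θ) = (2 * Real.pi) • g c := by
  have h := hg.circleAverage
  rw [Real.circleAverage] at h
  have hper : Function.Periodic (fun θ => g (circleMap c R θ)) (2 * Real.pi) :=
    (periodic_circleMap c R).comp g
  have h2 := hper.intervalIntegral_add_eq 0 (-Real.pi)
  rw [zero_add, show -Real.pi + 2 * Real.pi = Real.pi by ring] at h2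
  rw [← h2, ← h, smul_smul, mul_inv_cancel₀ (by positivity), one_smul]

theorem diffContOnCl_ball_of_differentiableOn {g : ℂ → ℂ} {c : ℂ} {r R : ℝ} (hr : 0 ≤ r)
    (hrR : r < R) (hg : DifferentiableOn ℂ g (Metric.ball c R)) :
    DiffContOnCl ℂ g (Metric.ball c |r|) := by
  rw [abs_of_nonneg hr]
  refine DifferentiableOn.diffContOnCl (hg.mono ?_)
  exact Metric.closure_ball_subset_closedBall.trans (Metric.closedBall_subset_ball hrR)

theorem lintegral_Ioo_ofReal_id {R : ℝ} (hR : 0 ≤ R) :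
    ∫⁻ r in Set.Ioo 0 R, ENNReal.ofReal r = ENNReal.ofReal (R ^ 2 / 2) := by
  rw [restrict_Ioo_eq_restrict_Ioc, ← ofReal_integral_eq_lintegral_ofReal,
    ← intervalIntegral.integral_of_le hR, integral_id]
  · simp
  · exact (continuous_id.integrableOn_Icc (a := 0) (b := R)).mono_set Set.Ioc_subset_Icc_self
  · exact (ae_restrict_mem measurableSet_Ioc).mono fun x hx => hx.1.le

theorem enorm_mul_area_le_lintegral {g : ℂ → ℂ} (hm : Measurable g) {R : ℝ} (hR : 0 ≤ R)
    (hg : DifferentiableOn ℂ g (Metric.ball 0 R)) :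
    ‖g 0‖ₑ * ENNReal.ofReal (Real.pi * R ^ 2) ≤ ∫⁻ z in Metric.ball 0 R, ‖g z‖ₑ := by
  have hsub : {z : ℂ | 0 < ‖z‖ ∧ ‖z‖ < R} ⊆ Metric.ball 0 R := fun z hz => by
    simpa using hz.2
  refine le_trans ?_ (lintegral_mono_set hsub)
  rw [lintegral_annulus_eq_polar hm.enorm le_rfl]
  have key : ∀ r ∈ Set.Ioo 0 R, ENNReal.ofReal r * (ENNReal.ofReal (2 * Real.pi) * ‖g 0‖ₑ) ≤
      ENNReal.ofReal r * ∫⁻ θ in Set.Ioo (-Real.pi) Real.pi, ‖g (circleMap 0 r θ)‖ₑ := by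
    intro r hr
    gcongr
    have h := integral_circleMap_eq (diffContOnCl_ball_of_differentiableOn hr.1.le hr.2 hg)
    rw [intervalIntegral.integral_of_le (by linarith [Real.pi_pos]),
      ← restrict_Ioo_eq_restrict_Ioc] at h
    have h3 := enorm_integral_le_lintegral_enorm
      (μ := volume.restrict (Set.Ioo (-Real.pi) Real.pi)) (fun θ => g (circleMap 0 r θ))
    rw [h, enorm_smul, Real.enorm_of_nonneg (by positivity)] at h3
    exact h3
  refine le_trans ?_ (setLIntegral_mono' measurableSet_Ioo key)
  rw [lintegral_mul_const _ ENNReal.measurable_ofReal, lintegral_Ioo_ofReal_id hR, ← mul_assoc,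
    mul_comm, ← ENNReal.ofReal_mul (by positivity)]
  exact le_of_eq (by congr 2; ring)

/-- The case `p = 1` is the mean value property. Hölder's inequality on the ball of area `V` raises
the exponent: after taking `p`-th powers, a factor `V^(p-1)` cancels. -/
theorem enorm_rpow_mul_area_le_lintegral {g : ℂ → ℂ} (hm : Measurable g) {c : ℂ} {R p : ℝ}
    (hp : 1 ≤ p) (hR : 0 < R) (hg : DifferentiableOn ℂ g (Metric.ball c R)) :
    ‖g c‖ₑ ^ p * ENNReal.ofReal (Real.pi * R ^ 2) ≤ ∫⁻ z in Metric.ball c R, ‖g z‖ₑ ^ p := by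
  have hp0 : 0 < p := by linarith
  have h1 : ‖g c‖ₑ * ENNReal.ofReal (Real.pi * R ^ 2) ≤ ∫⁻ z in Metric.ball c R, ‖g z‖ₑ := by
    have h := enorm_mul_area_le_lintegral (g := fun z => g (z + c))
      (hm.comp (measurable_id.add_const c)) hR.le (by
        refine hg.comp (by fun_prop) fun z hz => ?_
        simpa [dist_eq_norm] using hz)
    have hmp := (measurePreserving_add_right (volume : Measure ℂ) c).setLIntegral_comp_preimage
      (s := Metric.ball c R) measurableSet_ball (f := fun z => ‖g z‖ₑ) hm.enorm
    rw [← hmp]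
    convert h using 3
    · simp
    · ext z; simp [dist_eq_norm]
  have hvol : (volume.restrict (Metric.ball c R)) Set.univ = ENNReal.ofReal (Real.pi * R ^ 2) := by
    rw [Measure.restrict_apply_univ, Complex.volume_ball, ENNReal.ofReal_mul Real.pi_pos.le,
      ← ENNReal.ofReal_pow hR.le, mul_comm]
    congr 1
    exact (ENNReal.ofReal_coe_nnreal (p := NNReal.pi)).symm
  have h2 := eLpNorm_le_eLpNorm_mul_rpow_measure_univ (μ := volume.restrict (Metric.ball c R))
    (p := 1) (q := ENNReal.ofReal p) (f := g) (by simpa using hp) hm.aestronglyMeasurable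
  rw [eLpNorm_one_eq_lintegral_enorm, eLpNorm_eq_lintegral_rpow_enorm_toReal (by simpa using hp0)
    ENNReal.ofReal_ne_top, ENNReal.toReal_ofReal hp0.le, hvol] at h2
  simp only [ENNReal.toReal_one] at h2
  set V := ENNReal.ofReal (Real.pi * R ^ 2) with hV
  have hV0 : V ≠ 0 := by
    rw [hV]; simp only [ne_eq, ENNReal.ofReal_eq_zero, not_le]; positivity
  have hVt : V ≠ ∞ := ENNReal.ofReal_ne_top
  have h3 := ENNReal.rpow_le_rpow (h1.trans h2) hp0.le
  rw [ENNReal.mul_rpow_of_nonneg _ _ hp0.le, ENNReal.mul_rpow_of_nonneg _ _ hp0.le,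
    ← ENNReal.rpow_mul, ← ENNReal.rpow_mul, one_div, inv_mul_cancel₀ hp0.ne', ENNReal.rpow_one] at h3
  have h4 : V ^ p = V * V ^ (p - 1) := by
    conv_rhs => rw [← ENNReal.rpow_one V, ← ENNReal.rpow_mul, one_mul]
    rw [← ENNReal.rpow_add _ _ hV0 hVt]; congr 1; ring
  have h5 : (1 / 1 - p⁻¹) * p = p - 1 := by field_simp
  rw [h4, h5, ← mul_assoc] at h3
  exact (ENNReal.mul_le_mul_iff_left (by simp [hV0, hVt]) (by simp [hV0, hVt])).1 h3

/-! ### The disc and its automorphisms -/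

theorem mem_disc {z : ℂ} : z ∈ disc ↔ ‖z‖ < 1 := by simp [disc]

theorem isOpen_disc : IsOpen disc := Metric.isOpen_ball

theorem measurableSet_disc : MeasurableSet disc := isOpen_disc.measurableSet

theorem zero_mem_disc : (0 : ℂ) ∈ disc := by simp [mem_disc]

theorem one_sub_conj_mul_ne_zero {a z : ℂ} (ha : a ∈ disc) (hz : z ∈ disc) :
    1 - (starRingEnd ℂ) a * z ≠ 0 := by
  rw [mem_disc] at ha hz
  intro h
  have h1 : ‖(starRingEnd ℂ) a * z‖ = 1 := by rw [← sub_eq_zero.1 h]; simp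
  rw [norm_mul, RCLike.norm_conj] at h1
  nlinarith [norm_nonneg a, norm_nonneg z]

theorem norm_one_sub_conj_mul_sq (a z : ℂ) :
    ‖1 - (starRingEnd ℂ) a * z‖ ^ 2 = ‖a - z‖ ^ 2 + (1 - ‖a‖ ^ 2) * (1 - ‖z‖ ^ 2) := by
  simp only [Complex.sq_norm, Complex.normSq_apply, Complex.sub_re, Complex.sub_im, Complex.mul_re,
    Complex.mul_im, Complex.conj_re, Complex.conj_im, Complex.one_re, Complex.one_im]
  ring

theorem one_sub_norm_mobius_sq {a z : ℂ} (ha : a ∈ disc) (hz : z ∈ disc) :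
    1 - ‖mobius a z‖ ^ 2 =
      (1 - ‖z‖ ^ 2) * ((1 - ‖a‖ ^ 2) / ‖1 - (starRingEnd ℂ) a * z‖ ^ 2) := by
  have h0 : ‖1 - (starRingEnd ℂ) a * z‖ ^ 2 ≠ 0 := by
    simpa using one_sub_conj_mul_ne_zero ha hz
  rw [mobius, norm_div, div_pow, mul_div_assoc', eq_div_iff h0, sub_mul, div_mul_cancel₀ _ h0,
    norm_one_sub_conj_mul_sq]
  ring

theorem mobius_mem_disc {a z : ℂ} (ha : a ∈ disc) (hz : z ∈ disc) : mobius a z ∈ disc := by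
  have h := one_sub_norm_mobius_sq ha hz
  have h0 : 0 < ‖1 - (starRingEnd ℂ) a * z‖ := norm_pos_iff.2 (one_sub_conj_mul_ne_zero ha hz)
  rw [mem_disc] at *
  have h1 : 0 < 1 - ‖z‖ ^ 2 := by nlinarith [norm_nonneg z]
  have h2 : 0 < 1 - ‖a‖ ^ 2 := by nlinarith [norm_nonneg a]
  have : 0 < 1 - ‖mobius a z‖ ^ 2 := by rw [h]; positivity
  nlinarith [norm_nonneg (mobius a z)]

theorem mobius_mobius {a z : ℂ} (ha : a ∈ disc) (hz : z ∈ disc) : mobius a (mobius a z) = z := by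
  have h0 := one_sub_conj_mul_ne_zero ha hz
  have h1 := one_sub_conj_mul_ne_zero ha (mobius_mem_disc ha hz)
  have hq : mobius a z * (1 - (starRingEnd ℂ) a * z) = a - z := div_mul_cancel₀ _ h0
  rw [mobius, div_eq_iff h1]
  linear_combination -hq

theorem mobius_self (a : ℂ) : mobius a a = 0 := by simp [mobius]

theorem mobius_zero_right (a : ℂ) : mobius a 0 = a := by simp [mobius]

theorem injOn_mobius {a : ℂ} (ha : a ∈ disc) : Set.InjOn (mobius a) disc := fun z hz w hw h => by
  rw [← mobius_mobius ha hz, h, mobius_mobius ha hw]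

theorem image_mobius {a : ℂ} (ha : a ∈ disc) : mobius a '' disc = disc := by
  refine Set.Subset.antisymm (Set.image_subset_iff.2 fun z hz => mobius_mem_disc ha hz) fun z hz => ?_
  exact ⟨mobius a z, mobius_mem_disc ha hz, mobius_mobius ha hz⟩

theorem hasDerivAt_mobius {a z : ℂ} (ha : a ∈ disc) (hz : z ∈ disc) :
    HasDerivAt (mobius a) (-(1 - (starRingEnd ℂ) a * a) / (1 - (starRingEnd ℂ) a * z) ^ 2) z := by
  have h := ((hasDerivAt_id z).const_sub a).div
    (((hasDerivAt_id z).const_mul ((starRingEnd ℂ) a)).const_sub 1) (one_sub_conj_mul_ne_zero ha hz)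
  refine HasDerivAt.congr_deriv (f := mobius a) h ?_
  simp only [id]
  congr 1
  ring

theorem norm_deriv_mobius {a z : ℂ} (ha : a ∈ disc) (hz : z ∈ disc) :
    ‖deriv (mobius a) z‖ = (1 - ‖a‖ ^ 2) / ‖1 - (starRingEnd ℂ) a * z‖ ^ 2 := by
  rw [(hasDerivAt_mobius ha hz).deriv, norm_div, norm_neg, norm_pow, mul_comm _ a, Complex.mul_conj,
    Complex.normSq_eq_norm_sq]
  congr 1
  rw [mem_disc] at ha
  rw [← Complex.ofReal_one, ← Complex.ofReal_sub, Complex.norm_real, Real.norm_of_nonneg]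
  nlinarith [norm_nonneg a]

theorem one_sub_norm_mobius_sq' {a z : ℂ} (ha : a ∈ disc) (hz : z ∈ disc) :
    1 - ‖mobius a z‖ ^ 2 = (1 - ‖z‖ ^ 2) * ‖deriv (mobius a) z‖ := by
  rw [norm_deriv_mobius ha hz, one_sub_norm_mobius_sq ha hz]

theorem differentiableOn_mobius {a : ℂ} (ha : a ∈ disc) : DifferentiableOn ℂ (mobius a) disc :=
  fun _ hz => (hasDerivAt_mobius ha hz).differentiableAt.differentiableWithinAt

theorem mapsTo_mobius {a : ℂ} (ha : a ∈ disc) : Set.MapsTo (mobius a) disc disc :=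
  fun _ hz => mobius_mem_disc ha hz

theorem differentiableAt_of_mem_disc {f : ℂ → ℂ} (hf : DifferentiableOn ℂ f disc) {z : ℂ}
    (hz : z ∈ disc) : DifferentiableAt ℂ f z :=
  hf.differentiableAt (isOpen_disc.mem_nhds hz)

theorem one_sub_norm_sq_pos {z : ℂ} (hz : z ∈ disc) : 0 < 1 - ‖z‖ ^ 2 := by
  rw [mem_disc] at hz; nlinarith [norm_nonneg z]

/-! ### Change of variables -/

theorem det_restrictScalars_toSpanSingleton (d : ℂ) :
    ((ContinuousLinearMap.toSpanSingleton ℂ d).restrictScalars ℝ).det = ‖d‖ ^ 2 := by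
  have h := LinearMap.det_restrictScalars (R := ℝ) (S := ℂ)
    (f := (ContinuousLinearMap.toSpanSingleton ℂ d : ℂ →ₗ[ℂ] ℂ))
  rw [ContinuousLinearMap.det]
  refine (Eq.trans ?_ h).trans ?_
  · rfl
  · simp [Algebra.norm_complex_apply, Complex.normSq_eq_norm_sq]

theorem lintegral_image_eq_lintegral_enorm_deriv_sq {ψ : ℂ → ℂ} {S : Set ℂ} (hS : MeasurableSet S)
    (hd : ∀ z ∈ S, DifferentiableAt ℂ ψ z) (hinj : Set.InjOn ψ S) (g : ℂ → ℝ≥0∞) :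
    ∫⁻ w in ψ '' S, g w = ∫⁻ z in S, ‖deriv ψ z‖ₑ ^ 2 * g (ψ z) := by
  rw [lintegral_image_eq_lintegral_abs_det_fderiv_mul volume hS
    (f' := fun z => (ContinuousLinearMap.toSpanSingleton ℂ (deriv ψ z)).restrictScalars ℝ)
    (fun z hz => ((hd z hz).hasDerivAt.hasFDerivAt.restrictScalars ℝ).hasFDerivWithinAt) hinj]
  refine setLIntegral_congr_fun hS fun z _ => ?_
  simp only [det_restrictScalars_toSpanSingleton]
  rw [abs_of_nonneg (by positivity), ENNReal.ofReal_pow (norm_nonneg _), ofReal_norm]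

theorem lintegral_enorm_deriv_sq_eq_volume_image {ψ : ℂ → ℂ} {S : Set ℂ} (hS : MeasurableSet S)
    (hd : ∀ z ∈ S, DifferentiableAt ℂ ψ z) (hinj : Set.InjOn ψ S) :
    ∫⁻ z in S, ‖deriv ψ z‖ₑ ^ 2 = volume (ψ '' S) := by
  have h := lintegral_image_eq_lintegral_enorm_deriv_sq hS hd hinj 1
  simpa using h.symm

/-- Substitution by the involution `φ_a`, with `1-|φ_a|² = (1-|z|²)|φ_a'|` absorbing the Jacobian.
The free factor `v` allows localization: it is taken to be `1` or the indicator of an annulus. -/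
theorem lintegral_mobius_weight_eq {p : ℝ} (hp : 0 ≤ p) {f : ℂ → ℂ} (hf : DifferentiableOn ℂ f disc)
    {a : ℂ} (ha : a ∈ disc) (v : ℂ → ℝ≥0∞) :
    ∫⁻ z in disc, ‖deriv f z‖ₑ ^ p *
        ENNReal.ofReal ((1 - ‖z‖ ^ 2) ^ (p - 2) * (1 - ‖mobius a z‖ ^ 2)) * v (mobius a z) =
      ∫⁻ z in disc, ‖deriv (f ∘ mobius a) z‖ₑ ^ p * ENNReal.ofReal ((1 - ‖z‖ ^ 2) ^ (p - 1)) *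
        v z := by
  conv_lhs => rw [← image_mobius ha]
  rw [lintegral_image_eq_lintegral_enorm_deriv_sq measurableSet_disc
    (fun z hz => (hasDerivAt_mobius ha hz).differentiableAt) (injOn_mobius ha)]
  refine setLIntegral_congr_fun measurableSet_disc fun z hz => ?_
  have hφ := mobius_mem_disc ha hz
  rw [mobius_mobius ha hz, deriv_comp _ (differentiableAt_of_mem_disc hf hφ)
    (hasDerivAt_mobius ha hz).differentiableAt, enorm_mul, ENNReal.mul_rpow_of_nonneg _ _ hp,
    one_sub_norm_mobius_sq' ha hz]
  have h1 := one_sub_norm_sq_pos hz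
  have hd : 0 < ‖deriv (mobius a) z‖ := by
    have := one_sub_norm_mobius_sq' ha hz
    have h3 := one_sub_norm_sq_pos hφ
    rw [this] at h3
    exact pos_of_mul_pos_right h3 h1.le
  have e1 : ‖deriv (mobius a) z‖ₑ ^ 2 * ENNReal.ofReal
      (((1 - ‖z‖ ^ 2) * ‖deriv (mobius a) z‖) ^ (p - 2) * (1 - ‖z‖ ^ 2)) =
      ‖deriv (mobius a) z‖ₑ ^ p * ENNReal.ofReal ((1 - ‖z‖ ^ 2) ^ (p - 1)) := by
    rw [← ofReal_norm, ← ENNReal.ofReal_pow hd.le, ENNReal.ofReal_rpow_of_pos hd,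
      ← ENNReal.ofReal_mul (by positivity), ← ENNReal.ofReal_mul (by positivity)]
    congr 1
    rw [Real.mul_rpow h1.le hd.le]
    have e2 : (1 - ‖z‖ ^ 2) ^ (p - 1) = (1 - ‖z‖ ^ 2) ^ (p - 2) * (1 - ‖z‖ ^ 2) := by
      rw [← Real.rpow_add_one h1.ne']; congr 1; ring
    have e3 : ‖deriv (mobius a) z‖ ^ p =
        ‖deriv (mobius a) z‖ ^ (p - 2) * ‖deriv (mobius a) z‖ ^ 2 := by
      rw [← Real.rpow_natCast, ← Real.rpow_add hd]; congr 1; push_cast; ring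
    rw [e2, e3]; ring
  calc _ = ‖deriv f (mobius a z)‖ₑ ^ p * (‖deriv (mobius a) z‖ₑ ^ 2 * ENNReal.ofReal
      (((1 - ‖z‖ ^ 2) * ‖deriv (mobius a) z‖) ^ (p - 2) * (1 - ‖z‖ ^ 2))) * v z := by ring
    _ = _ := by rw [e1]; ring

/-- The Dirichlet type integral `∫_𝔻 |f'(z)|^p (1 - |z|²)^(p-1)`, with respect to unnormalized
area. -/
noncomputable def dirichletIntegral (p : ℝ) (f : ℂ → ℂ) : ℝ≥0∞ :=
  ∫⁻ z in disc, ‖deriv f z‖ₑ ^ p * ENNReal.ofReal ((1 - ‖z‖ ^ 2) ^ (p - 1))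

theorem bmoaIntegral_eq_dirichletIntegral {p : ℝ} (hp : 0 ≤ p) {f : ℂ → ℂ}
    (hf : DifferentiableOn ℂ f disc) {a : ℂ} (ha : a ∈ disc) :
    bmoaIntegral p f a = ENNReal.ofReal (1 / Real.pi) * dirichletIntegral p (f ∘ mobius a) := by
  have h := lintegral_mobius_weight_eq hp hf ha 1
  simp only [Pi.one_apply, mul_one] at h
  rw [bmoaIntegral, area, lintegral_smul_measure, h]
  rfl

/-! ### The area of preimages of hyperbolic discs -/

/-- The harmonic function `Re h` has mean `1` on every circle, so its integral over an annulus is at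
most `2π` times the width. -/
theorem lintegral_annulus_re_le {h : ℂ → ℂ} (hm : Measurable h) (hd : DifferentiableOn ℂ h disc)
    (hpos : ∀ z ∈ disc, 0 ≤ (h z).re) (h0 : h 0 = 1) {s : ℝ} (hs : 0 ≤ s) :
    ∫⁻ z in {z : ℂ | s < ‖z‖ ∧ ‖z‖ < 1}, ENNReal.ofReal (h z).re ≤
      ENNReal.ofReal (2 * Real.pi * (1 - s)) := by
  rw [lintegral_annulus_eq_polar (F := fun z => ENNReal.ofReal (h z).re)
    (Complex.measurable_re.comp hm).ennreal_ofReal hs]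
  have key : ∀ r ∈ Set.Ioo s 1, ENNReal.ofReal r *
      ∫⁻ θ in Set.Ioo (-Real.pi) Real.pi, ENNReal.ofReal (h (circleMap 0 r θ)).re ≤
      ENNReal.ofReal (2 * Real.pi) := by
    intro r hr
    have hr0 : 0 ≤ r := hs.trans hr.1.le
    have hmem : ∀ θ, circleMap 0 r θ ∈ disc := fun θ => by
      simpa [mem_disc, abs_of_nonneg hr0] using hr.2
    have hcont : Continuous fun θ => h (circleMap 0 r θ) :=
      hd.continuousOn.comp_continuous (continuous_circleMap 0 r) hmem
    have hI := integral_circleMap_eq (diffContOnCl_ball_of_differentiableOn hr0 hr.2 hd)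
    have hre : ∫ θ in (-Real.pi)..Real.pi, (h (circleMap 0 r θ)).re = 2 * Real.pi := by
      have := Complex.reCLM.intervalIntegral_comp_comm
        (hcont.intervalIntegrable (μ := volume) (-Real.pi) Real.pi)
      simp only [Complex.reCLM_apply] at this
      rw [this, hI, h0]; simp
    rw [intervalIntegral.integral_of_le (by linarith [Real.pi_pos])] at hre
    rw [restrict_Ioo_eq_restrict_Ioc, ← ofReal_integral_eq_lintegral_ofReal, hre]
    · exact mul_le_of_le_one_left (zero_le) (by simpa using hr.2.le)
    · exact (Complex.continuous_re.comp hcont).integrableOn_Ioc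
    · exact Eventually.of_forall fun θ => hpos _ (hmem θ)
  refine (setLIntegral_mono' measurableSet_Ioo key).trans ?_
  rw [lintegral_const, Measure.restrict_apply_univ, Real.volume_Ioo,
    ← ENNReal.ofReal_mul (by positivity)]

theorem re_one_add_div_one_sub {u : ℂ} (hu : ‖u‖ < 1) :
    ((1 + u) / (1 - u)).re = (1 - ‖u‖ ^ 2) / ‖1 - u‖ ^ 2 := by
  have h1 : 1 - u ≠ 0 := by
    intro h; rw [← sub_eq_zero.1 h] at hu; simp at hu
  have h2 : Complex.normSq (1 - u) ≠ 0 := by simpa using h1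
  rw [Complex.sq_norm, Complex.sq_norm, Complex.div_re, ← add_div]
  congr 1
  simp only [Complex.normSq_apply, Complex.add_re, Complex.sub_re, Complex.add_im, Complex.sub_im,
    Complex.one_re, Complex.one_im]
  ring

/-- The points of the disc which `ψ` maps hyperbolically close to `ζ`. -/
def nearPreimage (ψ : ℂ → ℂ) (ζ : ℂ) : Set ℂ :=
  {z | z ∈ disc ∧ ‖ψ z - ζ‖ < (1 - ‖ψ z‖) / 2}

theorem measurableSet_nearPreimage {ψ : ℂ → ℂ} (hm : Measurable ψ) (ζ : ℂ) :
    MeasurableSet (nearPreimage ψ ζ) :=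
  measurableSet_disc.inter (measurableSet_lt (hm.sub_const ζ).norm
    ((measurable_const.sub hm.norm).div_const 2))

theorem one_sub_norm_lt_of_near {w ζ : ℂ} (h : ‖w - ζ‖ < (1 - ‖w‖) / 2) :
    1 - ‖w‖ < 2 * (1 - ‖ζ‖) ∧ 1 - ‖ζ‖ < 3 / 2 * (1 - ‖w‖) := by
  have h1 : ‖ζ‖ ≤ ‖w‖ + ‖w - ζ‖ := by
    rw [norm_sub_rev]; simpa using norm_add_le w (ζ - w)
  have h2 : ‖w‖ ≤ ‖ζ‖ + ‖w - ζ‖ := by simpa using norm_add_le ζ (w - ζ)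
  constructor <;> linarith

/-- The function `Re((1 + ζ̄ψ)/(1 - ζ̄ψ))` is nonnegative, equals `1` at `0` and is at least
`1/(9l)` on the set, which lies in an annulus of width at most `2l`. Markov's inequality gives the
area bound `9l · 2π · 2l`. Univalence plays no role. -/
theorem volume_nearPreimage_le {ψ : ℂ → ℂ} (hm : Measurable ψ) (hd : DifferentiableOn ℂ ψ disc)
    (hmaps : Set.MapsTo ψ disc disc) (h0 : ψ 0 = 0) {ζ : ℂ} (hζ : ζ ∈ disc) :
    volume (nearPreimage ψ ζ) ≤ ENNReal.ofReal (36 * Real.pi * (1 - ‖ζ‖) ^ 2) := by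
  set l := 1 - ‖ζ‖ with hl
  have hl0 : 0 < l := by rw [mem_disc] at hζ; linarith
  set s := max 0 (1 - 2 * l) with hs
  set A := {z : ℂ | s < ‖z‖ ∧ ‖z‖ < 1} with hA
  have hAm : MeasurableSet A :=
    (measurableSet_lt measurable_const measurable_norm).inter
      (measurableSet_lt measurable_norm measurable_const)
  set h : ℂ → ℂ := fun z => (1 + (starRingEnd ℂ) ζ * ψ z) / (1 - (starRingEnd ℂ) ζ * ψ z) with hh
  have hhm : Measurable h := by
    exact (measurable_const.add (hm.const_mul _)).div (measurable_const.sub (hm.const_mul _))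
  have hu : ∀ z ∈ disc, ‖(starRingEnd ℂ) ζ * ψ z‖ < 1 := fun z hz => by
    have := mem_disc.1 (hmaps hz)
    rw [norm_mul, RCLike.norm_conj]
    rw [mem_disc] at hζ
    nlinarith [norm_nonneg ζ, norm_nonneg (ψ z)]
  have hann := lintegral_annulus_re_le hhm
    (DifferentiableOn.div ((differentiableOn_const _).add (hd.const_mul _))
      ((differentiableOn_const _).sub (hd.const_mul _))
      (fun z hz => one_sub_conj_mul_ne_zero hζ (hmaps hz)))
    (fun z hz => by
      rw [hh]; simp only
      rw [re_one_add_div_one_sub (hu z hz)]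
      have := hu z hz
      have : 0 ≤ 1 - ‖(starRingEnd ℂ) ζ * ψ z‖ ^ 2 := by
        nlinarith [norm_nonneg ((starRingEnd ℂ) ζ * ψ z)]
      positivity)
    (by simp [hh, h0]) (le_max_left 0 (1 - 2 * l))
  -- The numerator `1-|ζ̄ψ|²` is at least `l` and `|1-ζ̄ψ| ≤ 3l`, whence `1/(9l)`; Schwarz's lemma
  -- puts `z` in the annulus. The origin is set apart because the annulus with `s = 0` omits it.
  have hsub : nearPreimage ψ ζ ⊆
      insert 0 ({z | ENNReal.ofReal (1 / (9 * l)) ≤ ENNReal.ofReal (h z).re} ∩ A) := by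
    rintro z ⟨hz, hzζ⟩
    rcases eq_or_ne z 0 with rfl | hz0
    · exact Set.mem_insert _ _
    refine Set.mem_insert_of_mem _ ⟨?_, ?_, mem_disc.1 hz⟩
    · refine ENNReal.ofReal_le_ofReal ?_
      have hw := mem_disc.1 (hmaps hz)
      have hn := one_sub_norm_lt_of_near hzζ
      rw [hh]; simp only
      rw [re_one_add_div_one_sub (hu z hz), div_le_div_iff₀ (by positivity)
        (by have := norm_pos_iff.2 (one_sub_conj_mul_ne_zero hζ (hmaps hz)); positivity)]
      have hden : ‖1 - (starRingEnd ℂ) ζ * ψ z‖ ≤ 3 * l := by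
        have e : 1 - (starRingEnd ℂ) ζ * ψ z =
            ((1 - ‖ζ‖ ^ 2 : ℝ) : ℂ) + (starRingEnd ℂ) ζ * (ζ - ψ z) := by
          rw [mul_sub, mul_comm _ ζ, Complex.mul_conj, Complex.normSq_eq_norm_sq]
          push_cast; ring
        rw [e]
        refine (norm_add_le _ _).trans ?_
        rw [Complex.norm_real, Real.norm_of_nonneg (one_sub_norm_sq_pos hζ).le, norm_mul,
          RCLike.norm_conj, norm_sub_rev ζ]
        nlinarith [norm_nonneg ζ, norm_nonneg (ψ z - ζ)]
      have hnum : l ≤ 1 - ‖(starRingEnd ℂ) ζ * ψ z‖ ^ 2 := by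
        rw [norm_mul, RCLike.norm_conj, mul_pow]
        have : ‖ψ z‖ ^ 2 ≤ 1 := by nlinarith [norm_nonneg (ψ z)]
        nlinarith [norm_nonneg ζ, sq_nonneg ‖ζ‖]
      have := norm_nonneg (1 - (starRingEnd ℂ) ζ * ψ z)
      nlinarith
    · rw [max_lt_iff]
      refine ⟨norm_pos_iff.2 hz0, ?_⟩
      have hsch : ‖ψ z‖ ≤ ‖z‖ := Complex.norm_le_norm_of_mapsTo_ball hd
        (hmaps.mono_right Metric.ball_subset_closedBall) h0 (mem_disc.1 hz)
      have := (one_sub_norm_lt_of_near hzζ).1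
      linarith
  have hmark := mul_meas_ge_le_lintegral (μ := volume.restrict A)
    (Complex.measurable_re.comp hhm).ennreal_ofReal (ENNReal.ofReal (1 / (9 * l)))
  rw [Measure.restrict_apply' hAm] at hmark
  have h1 := hmark.trans hann
  have h2 : volume (nearPreimage ψ ζ) ≤
      volume ({z | ENNReal.ofReal (1 / (9 * l)) ≤ ENNReal.ofReal (h z).re} ∩ A) := by
    refine (measure_mono hsub).trans ?_
    rw [Set.insert_eq]
    refine (measure_union_le _ _).trans ?_
    simp
  have h3 : 1 - s ≤ 2 * l := by
    have := le_max_right 0 (1 - 2 * l); linarith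
  calc volume (nearPreimage ψ ζ) ≤ _ := h2
    _ = ENNReal.ofReal (9 * l) * (ENNReal.ofReal (1 / (9 * l)) *
        volume ({z | ENNReal.ofReal (1 / (9 * l)) ≤ ENNReal.ofReal (h z).re} ∩ A)) := by
      rw [← mul_assoc, ← ENNReal.ofReal_mul (by positivity), mul_one_div_cancel (by positivity)]
      simp
    _ ≤ ENNReal.ofReal (9 * l) * ENNReal.ofReal (2 * Real.pi * (1 - s)) := by
      gcongr; exact h1
    _ = ENNReal.ofReal (9 * l * (2 * Real.pi * (1 - s))) := by
      rw [← ENNReal.ofReal_mul (by positivity)]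
    _ ≤ _ := by
      refine ENNReal.ofReal_le_ofReal ?_
      calc 9 * l * (2 * Real.pi * (1 - s)) ≤ 9 * l * (2 * Real.pi * (2 * l)) := by gcongr
        _ = _ := by ring

theorem rpow_le_one_add_sq (x : ℝ≥0∞) {p : ℝ} (hp0 : 0 ≤ p) (hp2 : p ≤ 2) :
    x ^ p ≤ 1 + x ^ 2 := by
  rcases le_total x 1 with h | h
  · exact (ENNReal.rpow_le_one h hp0).trans le_self_add
  · calc x ^ p ≤ x ^ (2 : ℝ) := ENNReal.rpow_le_rpow_of_exponent_le h hp2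
      _ = x ^ 2 := by norm_cast
      _ ≤ _ := le_add_self

/-- By Schwarz's lemma the weight is at most `4 l^(p-1)`. The bound `|ψ'|^p ≤ 1 + |ψ'|²` leaves the
area of the set, `36π l²`, and that of its image, which lies in a disc of radius `l`; `148 = 4 · (36
+ 1)`. -/
theorem lintegral_nearPreimage_le {p : ℝ} (hp1 : 1 ≤ p) (hp2 : p ≤ 2) {ψ : ℂ → ℂ}
    (hm : Measurable ψ) (hd : DifferentiableOn ℂ ψ disc) (hmaps : Set.MapsTo ψ disc disc)
    (hinj : Set.InjOn ψ disc) (h0 : ψ 0 = 0) {ζ : ℂ} (hζ : ζ ∈ disc) :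
    ∫⁻ z in nearPreimage ψ ζ, ‖deriv ψ z‖ₑ ^ p * ENNReal.ofReal ((1 - ‖z‖ ^ 2) ^ (p - 1)) ≤
      ENNReal.ofReal (148 * Real.pi * (1 - ‖ζ‖) ^ (p + 1)) := by
  set l := 1 - ‖ζ‖ with hl
  have hl0 : 0 < l := by rw [mem_disc] at hζ; linarith
  have hEm := measurableSet_nearPreimage hm ζ
  have hpt : ∀ z ∈ nearPreimage ψ ζ,
      ‖deriv ψ z‖ₑ ^ p * ENNReal.ofReal ((1 - ‖z‖ ^ 2) ^ (p - 1)) ≤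
      ENNReal.ofReal (4 * l ^ (p - 1)) * (1 + ‖deriv ψ z‖ₑ ^ 2) := by
    rintro z ⟨hz, hzζ⟩
    rw [mul_comm]
    gcongr
    · have hsch : ‖ψ z‖ ≤ ‖z‖ := Complex.norm_le_norm_of_mapsTo_ball hd
        (hmaps.mono_right Metric.ball_subset_closedBall) h0 (mem_disc.1 hz)
      have h1 := (one_sub_norm_lt_of_near hzζ).1
      have h2 : 1 - ‖z‖ ^ 2 ≤ 4 * l := by
        have := mem_disc.1 hz
        nlinarith [norm_nonneg z]
      calc (1 - ‖z‖ ^ 2) ^ (p - 1) ≤ (4 * l) ^ (p - 1) :=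
            Real.rpow_le_rpow (one_sub_norm_sq_pos hz).le h2 (by linarith)
        _ = 4 ^ (p - 1) * l ^ (p - 1) := Real.mul_rpow (by norm_num) hl0.le
        _ ≤ 4 ^ (1 : ℝ) * l ^ (p - 1) := by
          gcongr
          · norm_num
          · linarith
        _ = _ := by simp
    · exact rpow_le_one_add_sq _ (by linarith) hp2
  refine (setLIntegral_mono' hEm hpt).trans ?_
  rw [lintegral_const_mul' _ _ ENNReal.ofReal_ne_top,
    lintegral_add_left measurable_const, lintegral_enorm_deriv_sq_eq_volume_image hEm
      (fun z hz => differentiableAt_of_mem_disc hd hz.1) (hinj.mono fun z hz => hz.1)]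
  have himg : volume (ψ '' nearPreimage ψ ζ) ≤ ENNReal.ofReal (Real.pi * l ^ 2) := by
    have hsub : ψ '' nearPreimage ψ ζ ⊆ Metric.ball ζ l := by
      rintro _ ⟨z, ⟨hz, hzζ⟩, rfl⟩
      have h1 := (one_sub_norm_lt_of_near hzζ).1
      rw [Metric.mem_ball, dist_eq_norm]; linarith
    refine (measure_mono hsub).trans (le_of_eq ?_)
    rw [Complex.volume_ball, ENNReal.ofReal_mul Real.pi_pos.le, ← ENNReal.ofReal_pow hl0.le,
      mul_comm]
    congr 1
    exact (ENNReal.ofReal_coe_nnreal (p := NNReal.pi)).symm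
  have hvol := volume_nearPreimage_le hm hd hmaps h0 hζ
  rw [lintegral_const, Measure.restrict_apply_univ, one_mul]
  calc _ ≤ ENNReal.ofReal (4 * l ^ (p - 1)) *
      (ENNReal.ofReal (36 * Real.pi * l ^ 2) + ENNReal.ofReal (Real.pi * l ^ 2)) := by gcongr
    _ = ENNReal.ofReal (4 * l ^ (p - 1) * (36 * Real.pi * l ^ 2 + Real.pi * l ^ 2)) := by
      rw [← ENNReal.ofReal_add (by positivity) (by positivity),
        ← ENNReal.ofReal_mul (by positivity)]
    _ = _ := by
      congr 1
      rw [show p + 1 = (p - 1) + 2 by ring, Real.rpow_add hl0, Real.rpow_two]; ring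

/-! ### Composition with a univalent function fixing the origin -/

theorem enorm_rpow_comp_le_lintegral_near {p : ℝ} (hp1 : 1 ≤ p) {g : ℂ → ℂ} (hgm : Measurable g)
    (hg : DifferentiableOn ℂ g disc) {ψ : ℂ → ℂ} (hmaps : Set.MapsTo ψ disc disc) {t : ℝ} {z : ℂ}
    (hz : z ∈ disc) (hzt : 1 - ‖ψ z‖ < t) :
    ‖g (ψ z)‖ₑ ^ p ≤ ∫⁻ ζ in disc ∩ {ζ | 1 - ‖ζ‖ < 2 * t},
      (nearPreimage ψ ζ).indicator 1 z *
        (‖g ζ‖ₑ ^ p * ENNReal.ofReal (9 / (Real.pi * (1 - ‖ζ‖) ^ 2))) := by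
  set w := ψ z with hw
  have hwd : ‖w‖ < 1 := mem_disc.1 (hmaps hz)
  set R := (1 - ‖w‖) / 2 with hR
  have hR0 : 0 < R := by rw [hR]; linarith
  have hnear : ∀ ζ ∈ Metric.ball w R, ‖w - ζ‖ < (1 - ‖w‖) / 2 := fun ζ hζ => by
    rw [norm_sub_rev, ← dist_eq_norm]; exact hζ
  have hsub : Metric.ball w R ⊆ disc ∩ {ζ | 1 - ‖ζ‖ < 2 * t} := fun ζ hζ => by
    have h := one_sub_norm_lt_of_near (hnear ζ hζ)
    refine ⟨mem_disc.2 (by linarith), ?_⟩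
    simp only [Set.mem_ofPred_eq]; linarith
  have hmv := enorm_rpow_mul_area_le_lintegral hgm hp1 hR0
    (hg.mono (hsub.trans Set.inter_subset_left))
  have hc : 0 < Real.pi * R ^ 2 := by positivity
  calc ‖g w‖ₑ ^ p = ENNReal.ofReal (1 / (Real.pi * R ^ 2)) *
        (‖g w‖ₑ ^ p * ENNReal.ofReal (Real.pi * R ^ 2)) := by
        rw [mul_comm, mul_assoc, ← ENNReal.ofReal_mul hc.le, mul_one_div_cancel hc.ne']
        simp
    _ ≤ ENNReal.ofReal (1 / (Real.pi * R ^ 2)) * ∫⁻ ζ in Metric.ball w R, ‖g ζ‖ₑ ^ p := by gcongr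
    _ = ∫⁻ ζ in Metric.ball w R, ENNReal.ofReal (1 / (Real.pi * R ^ 2)) * ‖g ζ‖ₑ ^ p := by
        rw [lintegral_const_mul' _ _ ENNReal.ofReal_ne_top]
    _ ≤ ∫⁻ ζ in Metric.ball w R, (nearPreimage ψ ζ).indicator 1 z *
        (‖g ζ‖ₑ ^ p * ENNReal.ofReal (9 / (Real.pi * (1 - ‖ζ‖) ^ 2))) := by
        refine setLIntegral_mono' measurableSet_ball fun ζ hζ => ?_
        have hmem : z ∈ nearPreimage ψ ζ := ⟨hz, hnear ζ hζ⟩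
        have h := one_sub_norm_lt_of_near (hnear ζ hζ)
        have hζ0 : 0 < 1 - ‖ζ‖ := by linarith
        rw [Set.indicator_of_mem hmem, Pi.one_apply, one_mul, mul_comm]
        refine mul_le_mul_right (ENNReal.ofReal_le_ofReal ?_) _
        rw [div_le_div_iff₀ hc (by positivity)]
        -- This comparison gives the `9`: the radius `R` depends on `z`, and `1/R²` must be replaced
        -- by a quantity depending on `ζ` alone before the integrals are swapped.
        have h3 : 1 - ‖ζ‖ ≤ 3 * R := by rw [hR]; linarith [h.2]
        have : (1 - ‖ζ‖) ^ 2 ≤ (3 * R) ^ 2 := by gcongr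
        nlinarith [Real.pi_pos]
    _ ≤ _ := lintegral_mono_set hsub

/-- Mean value inequality inside, Tonelli, then the estimate over `nearPreimage`; `1332 = 9 · 148`.
The cutoff only doubles because hyperbolically close points have comparable distance to the circle.
-/
theorem lintegral_comp_weight_le_of_measurable {p : ℝ} (hp1 : 1 ≤ p) (hp2 : p ≤ 2) {g : ℂ → ℂ}
    (hgm : Measurable g) (hg : DifferentiableOn ℂ g disc) {ψ : ℂ → ℂ}
    (hm : Measurable ψ) (hd : DifferentiableOn ℂ ψ disc) (hmaps : Set.MapsTo ψ disc disc)
    (hinj : Set.InjOn ψ disc) (h0 : ψ 0 = 0) (t : ℝ) :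
    ∫⁻ z in disc ∩ {z | 1 - ‖ψ z‖ < t}, ‖g (ψ z)‖ₑ ^ p *
        (‖deriv ψ z‖ₑ ^ p * ENNReal.ofReal ((1 - ‖z‖ ^ 2) ^ (p - 1))) ≤
      1332 * ∫⁻ ζ in disc ∩ {ζ | 1 - ‖ζ‖ < 2 * t},
        ‖g ζ‖ₑ ^ p * ENNReal.ofReal ((1 - ‖ζ‖ ^ 2) ^ (p - 1)) := by
  set B := disc ∩ {ζ : ℂ | 1 - ‖ζ‖ < 2 * t} with hB
  have hBm : MeasurableSet B := measurableSet_disc.inter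
    (measurableSet_lt (measurable_const.sub measurable_norm) measurable_const)
  have hSm : MeasurableSet (disc ∩ {z | 1 - ‖ψ z‖ < t}) := measurableSet_disc.inter
    (measurableSet_lt (measurable_const.sub hm.norm) measurable_const)
  set k : ℂ → ℝ≥0∞ := fun z => ‖deriv ψ z‖ₑ ^ p * ENNReal.ofReal ((1 - ‖z‖ ^ 2) ^ (p - 1)) with hk
  have hkm : Measurable k := ((measurable_deriv ψ).enorm.pow_const p).mul
    (((measurable_const.sub (measurable_norm.pow_const 2)).pow_const (p - 1)).ennreal_ofReal)
  set u : ℂ → ℝ≥0∞ := fun ζ => ‖g ζ‖ₑ ^ p * ENNReal.ofReal (9 / (Real.pi * (1 - ‖ζ‖) ^ 2)) with hu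
  have hum : Measurable u := (hgm.enorm.pow_const p).mul
    ((measurable_const.div (((measurable_const.sub measurable_norm).pow_const 2).const_mul
      Real.pi)).ennreal_ofReal)
  have hind : Measurable (Function.uncurry fun z ζ =>
      (nearPreimage ψ ζ).indicator (1 : ℂ → ℝ≥0∞) z) := by
    have hset : MeasurableSet {q : ℂ × ℂ | q.1 ∈ nearPreimage ψ q.2} :=
      (measurable_fst measurableSet_disc).inter
        (measurableSet_lt (((hm.comp measurable_fst).sub measurable_snd).norm)
          ((measurable_const.sub (hm.comp measurable_fst).norm).div_const 2))
    exact measurable_one.indicator hset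
  calc ∫⁻ z in disc ∩ {z | 1 - ‖ψ z‖ < t}, ‖g (ψ z)‖ₑ ^ p * k z
      ≤ ∫⁻ z in disc ∩ {z | 1 - ‖ψ z‖ < t},
          (∫⁻ ζ in B, (nearPreimage ψ ζ).indicator 1 z * u ζ) * k z := by
        refine setLIntegral_mono' hSm fun z hz => ?_
        gcongr
        exact enorm_rpow_comp_le_lintegral_near hp1 hgm hg hmaps hz.1 hz.2
    _ ≤ ∫⁻ z in disc, (∫⁻ ζ in B, (nearPreimage ψ ζ).indicator 1 z * u ζ) * k z :=
        lintegral_mono_set Set.inter_subset_left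
    _ = ∫⁻ z in disc, ∫⁻ ζ in B, (nearPreimage ψ ζ).indicator 1 z * u ζ * k z := by
        refine lintegral_congr fun z => (lintegral_mul_const _ ?_).symm
        exact (hind.comp (measurable_const.prodMk measurable_id)).mul hum
    _ = ∫⁻ ζ in B, ∫⁻ z in disc, (nearPreimage ψ ζ).indicator 1 z * u ζ * k z := by
        refine lintegral_lintegral_swap (Measurable.aemeasurable ?_)
        exact (hind.mul (hum.comp measurable_snd)).mul (hkm.comp measurable_fst)
    _ ≤ ∫⁻ ζ in B, 1332 * (‖g ζ‖ₑ ^ p * ENNReal.ofReal ((1 - ‖ζ‖ ^ 2) ^ (p - 1))) := by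
        refine setLIntegral_mono' hBm fun ζ hζ => ?_
        have hE := measurableSet_nearPreimage hm ζ
        have e1 : ∫⁻ z in disc, (nearPreimage ψ ζ).indicator 1 z * u ζ * k z =
            u ζ * ∫⁻ z in nearPreimage ψ ζ, k z := by
          have e2 : ∀ z, (nearPreimage ψ ζ).indicator 1 z * u ζ * k z =
              u ζ * (nearPreimage ψ ζ).indicator k z := fun z => by
            by_cases hz : z ∈ nearPreimage ψ ζ <;> simp [hz]
          simp_rw [e2]
          rw [lintegral_const_mul _ (hkm.indicator hE), lintegral_indicator hE,
            Measure.restrict_restrict hE, Set.inter_eq_left.2 fun z hz => hz.1]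
        rw [e1]
        have hζ0 : 0 < 1 - ‖ζ‖ := by linarith [mem_disc.1 hζ.1]
        calc u ζ * ∫⁻ z in nearPreimage ψ ζ, k z
            ≤ u ζ * ENNReal.ofReal (148 * Real.pi * (1 - ‖ζ‖) ^ (p + 1)) := by
              gcongr
              exact lintegral_nearPreimage_le hp1 hp2 hm hd hmaps hinj h0 hζ.1
          _ = ‖g ζ‖ₑ ^ p * ENNReal.ofReal (1332 * (1 - ‖ζ‖) ^ (p - 1)) := by
              rw [hu, mul_assoc, ← ENNReal.ofReal_mul (by positivity)]
              congr 2
              rw [show p + 1 = (p - 1) + 2 by ring, Real.rpow_add hζ0, Real.rpow_two]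
              field_simp; ring
          _ ≤ ‖g ζ‖ₑ ^ p * ENNReal.ofReal (1332 * (1 - ‖ζ‖ ^ 2) ^ (p - 1)) := by
              gcongr
              nlinarith [norm_nonneg ζ]
          _ = _ := by
              rw [ENNReal.ofReal_mul (by norm_num)]
              rw [show ENNReal.ofReal 1332 = 1332 by simp]
              ring
    _ = _ := lintegral_const_mul' _ _ (by simp)

/-- Only the values of `ψ` on the disc matter, so extending by zero supplies global measurability.
-/
theorem lintegral_comp_weight_le {p : ℝ} (hp1 : 1 ≤ p) (hp2 : p ≤ 2) {g : ℂ → ℂ}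
    (hgm : Measurable g) (hg : DifferentiableOn ℂ g disc) {ψ : ℂ → ℂ}
    (hd : DifferentiableOn ℂ ψ disc) (hmaps : Set.MapsTo ψ disc disc)
    (hinj : Set.InjOn ψ disc) (h0 : ψ 0 = 0) (t : ℝ) :
    ∫⁻ z in disc ∩ {z | 1 - ‖ψ z‖ < t}, ‖g (ψ z)‖ₑ ^ p *
        (‖deriv ψ z‖ₑ ^ p * ENNReal.ofReal ((1 - ‖z‖ ^ 2) ^ (p - 1))) ≤
      1332 * ∫⁻ ζ in disc ∩ {ζ | 1 - ‖ζ‖ < 2 * t},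
        ‖g ζ‖ₑ ^ p * ENNReal.ofReal ((1 - ‖ζ‖ ^ 2) ^ (p - 1)) := by
  classical
  set χ : ℂ → ℂ := disc.piecewise ψ 0 with hχ
  have heq : Set.EqOn χ ψ disc := Set.piecewise_eqOn _ _ _
  have hχm : Measurable χ :=
    hd.continuousOn.measurable_piecewise continuousOn_const measurableSet_disc
  have hder : ∀ z ∈ disc, deriv χ z = deriv ψ z := fun z hz =>
    (heq.eventuallyEq_of_mem (isOpen_disc.mem_nhds hz)).deriv_eq
  have h := lintegral_comp_weight_le_of_measurable hp1 hp2 hgm hg hχm (hd.congr heq)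
    (hmaps.congr heq.symm) (hinj.congr heq.symm) ((heq zero_mem_disc).trans h0) t
  have hset : disc ∩ {z | 1 - ‖ψ z‖ < t} = disc ∩ {z | 1 - ‖χ z‖ < t} := by
    ext z
    refine and_congr_right fun hz => ?_
    simp only [Set.mem_ofPred_eq, heq hz]
  have hSm : MeasurableSet (disc ∩ {z | 1 - ‖χ z‖ < t}) := measurableSet_disc.inter
    (measurableSet_lt (measurable_const.sub hχm.norm) measurable_const)
  rw [hset]
  refine le_trans (le_of_eq ?_) h
  refine setLIntegral_congr_fun hSm fun z hz => ?_
  simp only [heq hz.1, hder z hz.1]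

/-! ### Möbius invariance -/

/-- The self-map `ψ` of the disc, recentred so that it fixes the origin. -/
noncomputable def recenter (ψ : ℂ → ℂ) (a : ℂ) : ℂ → ℂ := mobius (ψ a) ∘ ψ ∘ mobius a

theorem recenter_zero (ψ : ℂ → ℂ) (a : ℂ) : recenter ψ a 0 = 0 := by
  simp [recenter, mobius_zero_right, mobius_self]

theorem mapsTo_recenter {ψ : ℂ → ℂ} (hmaps : Set.MapsTo ψ disc disc) {a : ℂ} (ha : a ∈ disc) :
    Set.MapsTo (recenter ψ a) disc disc :=
  (mapsTo_mobius (hmaps ha)).comp (hmaps.comp (mapsTo_mobius ha))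

theorem differentiableOn_recenter {ψ : ℂ → ℂ} (hd : DifferentiableOn ℂ ψ disc)
    (hmaps : Set.MapsTo ψ disc disc) {a : ℂ} (ha : a ∈ disc) :
    DifferentiableOn ℂ (recenter ψ a) disc :=
  (differentiableOn_mobius (hmaps ha)).comp
    (hd.comp (differentiableOn_mobius ha) (mapsTo_mobius ha)) (hmaps.comp (mapsTo_mobius ha))

theorem injOn_recenter {ψ : ℂ → ℂ} (hmaps : Set.MapsTo ψ disc disc) (hinj : Set.InjOn ψ disc)
    {a : ℂ} (ha : a ∈ disc) : Set.InjOn (recenter ψ a) disc :=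
  (injOn_mobius (hmaps ha)).comp (hinj.comp (injOn_mobius ha) (mapsTo_mobius ha))
    (hmaps.comp (mapsTo_mobius ha))

theorem comp_recenter_eqOn (f : ℂ → ℂ) {ψ : ℂ → ℂ} (hmaps : Set.MapsTo ψ disc disc) {a : ℂ}
    (ha : a ∈ disc) :
    Set.EqOn (compOp ψ f ∘ mobius a) ((f ∘ mobius (ψ a)) ∘ recenter ψ a) disc := fun z hz => by
  simp only [Function.comp, compOp, recenter]
  rw [mobius_mobius (hmaps ha) (hmaps (mobius_mem_disc ha hz))]

theorem dirichletIntegral_congr (p : ℝ) {f g : ℂ → ℂ} (h : Set.EqOn f g disc) :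
    dirichletIntegral p f = dirichletIntegral p g :=
  setLIntegral_congr_fun measurableSet_disc fun z hz => by
    simp only [(h.eventuallyEq_of_mem (isOpen_disc.mem_nhds hz)).deriv_eq]

theorem differentiableOn_deriv {f : ℂ → ℂ} (hf : DifferentiableOn ℂ f disc) :
    DifferentiableOn ℂ (deriv f) disc := hf.deriv isOpen_disc

theorem enorm_deriv_comp_rpow {p : ℝ} (hp : 0 ≤ p) {F ψ : ℂ → ℂ} (hF : DifferentiableOn ℂ F disc)
    (hd : DifferentiableOn ℂ ψ disc) (hmaps : Set.MapsTo ψ disc disc) {z : ℂ} (hz : z ∈ disc) :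
    ‖deriv (F ∘ ψ) z‖ₑ ^ p = ‖deriv F (ψ z)‖ₑ ^ p * ‖deriv ψ z‖ₑ ^ p := by
  rw [deriv_comp _ (differentiableAt_of_mem_disc hF (hmaps hz)) (differentiableAt_of_mem_disc hd hz),
    enorm_mul, ENNReal.mul_rpow_of_nonneg _ _ hp]

theorem dirichletIntegral_comp_le {p : ℝ} (hp1 : 1 ≤ p) (hp2 : p ≤ 2) {F ψ : ℂ → ℂ}
    (hF : DifferentiableOn ℂ F disc) (hd : DifferentiableOn ℂ ψ disc)
    (hmaps : Set.MapsTo ψ disc disc) (hinj : Set.InjOn ψ disc) (h0 : ψ 0 = 0) :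
    dirichletIntegral p (F ∘ ψ) ≤ 1332 * dirichletIntegral p F := by
  -- With `t = 2` both cutoffs are vacuous.
  have h := lintegral_comp_weight_le hp1 hp2 (measurable_deriv F) (differentiableOn_deriv hF)
    hd hmaps hinj h0 2
  have e1 : disc ∩ {z | 1 - ‖ψ z‖ < 2} = disc := Set.inter_eq_left.2 fun z _ => by
    simp only [Set.mem_ofPred_eq]; linarith [norm_nonneg (ψ z)]
  have e2 : disc ∩ {ζ : ℂ | 1 - ‖ζ‖ < 2 * 2} = disc := Set.inter_eq_left.2 fun z _ => by
    simp only [Set.mem_ofPred_eq]; linarith [norm_nonneg z]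
  rw [e1, e2] at h
  refine le_trans (le_of_eq ?_) h
  refine setLIntegral_congr_fun measurableSet_disc fun z hz => ?_
  simp only [enorm_deriv_comp_rpow (zero_le_one.trans hp1) hF hd hmaps hz, mul_assoc]

theorem bmoaIntegral_comp_eq {p : ℝ} (hp : 0 ≤ p) {f ψ : ℂ → ℂ} (hf : DifferentiableOn ℂ f disc)
    (hd : DifferentiableOn ℂ ψ disc) (hmaps : Set.MapsTo ψ disc disc) {a : ℂ} (ha : a ∈ disc) :
    bmoaIntegral p (compOp ψ f) a = ENNReal.ofReal (1 / Real.pi) *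
      dirichletIntegral p ((f ∘ mobius (ψ a)) ∘ recenter ψ a) := by
  rw [bmoaIntegral_eq_dirichletIntegral hp (f := compOp ψ f) (hf.comp hd hmaps) ha,
    dirichletIntegral_congr p (comp_recenter_eqOn f hmaps ha)]

theorem bmoaIntegral_comp_le {p : ℝ} (hp1 : 1 ≤ p) (hp2 : p ≤ 2) {f ψ : ℂ → ℂ}
    (hf : DifferentiableOn ℂ f disc) (hd : DifferentiableOn ℂ ψ disc)
    (hmaps : Set.MapsTo ψ disc disc) (hinj : Set.InjOn ψ disc) {a : ℂ} (ha : a ∈ disc) :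
    bmoaIntegral p (compOp ψ f) a ≤ 1332 * bmoaIntegral p f (ψ a) := by
  have hp0 := zero_le_one.trans hp1
  rw [bmoaIntegral_comp_eq hp0 hf hd hmaps ha,
    bmoaIntegral_eq_dirichletIntegral hp0 hf (hmaps ha), mul_left_comm]
  gcongr
  exact dirichletIntegral_comp_le hp1 hp2
    (hf.comp (differentiableOn_mobius (hmaps ha)) (mapsTo_mobius (hmaps ha)))
    (differentiableOn_recenter hd hmaps ha) (mapsTo_recenter hmaps ha)
    (injOn_recenter hmaps hinj ha) (recenter_zero ψ a)

/-! ### Growth of functions in `BMOA_p` -/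

/-- Mean value inequality on the disc of radius `1/2`, where the weight is at least `3/4`; the
constant is `4 · 4/3 ≤ 6`. -/
theorem enorm_deriv_zero_rpow_le {p : ℝ} (hp1 : 1 ≤ p) (hp2 : p ≤ 2) {F : ℂ → ℂ}
    (hF : DifferentiableOn ℂ F disc) :
    ‖deriv F 0‖ₑ ^ p ≤ 6 * (ENNReal.ofReal (1 / Real.pi) * dirichletIntegral p F) := by
  have hsub : Metric.ball (0 : ℂ) (1 / 2) ⊆ disc := Metric.ball_subset_ball (by norm_num)
  have h := enorm_rpow_mul_area_le_lintegral (measurable_deriv F) (c := 0) (R := 1 / 2) hp1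
    (by norm_num) ((differentiableOn_deriv hF).mono hsub)
  have h2 : ∫⁻ z in Metric.ball (0 : ℂ) (1 / 2), ‖deriv F z‖ₑ ^ p ≤
      ENNReal.ofReal (4 / 3) * dirichletIntegral p F := by
    rw [dirichletIntegral, ← lintegral_const_mul' _ _ ENNReal.ofReal_ne_top]
    refine le_trans (setLIntegral_mono' measurableSet_ball fun z hz => ?_)
      (lintegral_mono_set hsub)
    have hz' : ‖z‖ < 1 / 2 := by simpa using hz
    rw [mul_left_comm, ← ENNReal.ofReal_mul (by norm_num)]
    refine le_mul_of_one_le_right (zero_le) ?_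
    rw [ENNReal.one_le_ofReal]
    have h3 : (3 / 4 : ℝ) ≤ 1 - ‖z‖ ^ 2 := by nlinarith [norm_nonneg z]
    have h4 : (3 / 4 : ℝ) ≤ (1 - ‖z‖ ^ 2) ^ (p - 1) :=
      calc (3 / 4 : ℝ) = (3 / 4) ^ (1 : ℝ) := by simp
        _ ≤ (3 / 4) ^ (p - 1) :=
          Real.rpow_le_rpow_of_exponent_ge (by norm_num) (by norm_num) (by linarith)
        _ ≤ _ := Real.rpow_le_rpow (by norm_num) h3 (by linarith)
    linarith
  have hπ := Real.pi_pos
  calc ‖deriv F 0‖ₑ ^ p = ENNReal.ofReal (4 / Real.pi) *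
        (‖deriv F 0‖ₑ ^ p * ENNReal.ofReal (Real.pi * (1 / 2) ^ 2)) := by
        rw [mul_left_comm, ← ENNReal.ofReal_mul (by positivity)]
        rw [show 4 / Real.pi * (Real.pi * (1 / 2) ^ 2) = 1 by field_simp; norm_num]
        simp
    _ ≤ ENNReal.ofReal (4 / Real.pi) * (ENNReal.ofReal (4 / 3) * dirichletIntegral p F) := by
        exact mul_le_mul_right (h.trans h2) _
    _ = ENNReal.ofReal (4 / Real.pi * (4 / 3)) * dirichletIntegral p F := by
        rw [← mul_assoc, ← ENNReal.ofReal_mul (by positivity)]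
    _ ≤ ENNReal.ofReal (6 * (1 / Real.pi)) * dirichletIntegral p F := by
        refine mul_le_mul_left (ENNReal.ofReal_le_ofReal ?_) _
        rw [div_mul_eq_mul_div, mul_one_div]
        gcongr; norm_num
    _ = _ := by
        rw [ENNReal.ofReal_mul (by norm_num), ← mul_assoc]
        simp

/-- The Bloch estimate: the bound at the origin applied to `f ∘ φ_b`, whose derivative there has
modulus `|f'(b)|(1-|b|²)`. -/
theorem enorm_deriv_mul_le {p : ℝ} (hp1 : 1 ≤ p) (hp2 : p ≤ 2) {f : ℂ → ℂ}
    (hf : DifferentiableOn ℂ f disc) {S : ℝ≥0∞} (hS : ∀ a ∈ disc, bmoaIntegral p f a ≤ S)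
    {b : ℂ} (hb : b ∈ disc) :
    ‖deriv f b‖ₑ * ENNReal.ofReal (1 - ‖b‖ ^ 2) ≤ 6 * S ^ (1 / p) := by
  have hp0 : 0 < p := by linarith
  have h1 := enorm_deriv_zero_rpow_le hp1 hp2 (F := f ∘ mobius b)
    (hf.comp (differentiableOn_mobius hb) (mapsTo_mobius hb))
  rw [← bmoaIntegral_eq_dirichletIntegral hp0.le hf hb, deriv_comp _
    (by rw [mobius_zero_right]; exact differentiableAt_of_mem_disc hf hb)
    (hasDerivAt_mobius hb zero_mem_disc).differentiableAt, mobius_zero_right] at h1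
  have e : ‖deriv f b * deriv (mobius b) 0‖ₑ = ‖deriv f b‖ₑ * ENNReal.ofReal (1 - ‖b‖ ^ 2) := by
    rw [enorm_mul, ← ofReal_norm (deriv (mobius b) 0), norm_deriv_mobius hb zero_mem_disc]
    simp
  rw [e] at h1
  have h2 := ENNReal.rpow_le_rpow (h1.trans (mul_le_mul_right (hS b hb) 6)) (z := 1 / p)
    (by positivity)
  rw [← ENNReal.rpow_mul, mul_one_div_cancel hp0.ne', ENNReal.rpow_one,
    ENNReal.mul_rpow_of_nonneg _ _ (by positivity)] at h2
  refine h2.trans ?_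
  gcongr
  calc (6 : ℝ≥0∞) ^ (1 / p) ≤ 6 ^ (1 : ℝ) := by
        refine ENNReal.rpow_le_rpow_of_exponent_le (by norm_num) ?_
        rw [div_le_one hp0]; exact hp1
    _ = 6 := by simp

theorem norm_sub_le_log_of_norm_deriv_le {f : ℂ → ℂ} (hf : DifferentiableOn ℂ f disc) {K : ℝ}
    (hK : ∀ b ∈ disc, ‖deriv f b‖ * (1 - ‖b‖ ^ 2) ≤ K) {w : ℂ} (hw : w ∈ disc) :
    ‖f w - f 0‖ ≤ K * Real.log ((1 + ‖w‖) / (1 - ‖w‖)) := by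
  set ρ := ‖w‖ with hρ
  have hρ0 : 0 ≤ ρ := norm_nonneg w
  have hρ1 : ρ < 1 := mem_disc.1 hw
  have hmem : ∀ t ∈ Set.Icc (0 : ℝ) 1, (t : ℂ) * w ∈ disc := fun t ht => by
    rw [mem_disc, norm_mul, Complex.norm_real, Real.norm_of_nonneg ht.1]
    nlinarith [ht.2]
  have hder : ∀ t ∈ Set.Icc (0 : ℝ) 1,
      HasDerivAt (fun t : ℝ => f (t * w) - f 0) (deriv f (t * w) * w) t := fun t ht => by
    have h1 : HasDerivAt (fun t : ℝ => (t : ℂ) * w) w t := by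
      simpa using (Complex.ofRealCLM.hasDerivAt (x := t)).mul_const w
    have h2 := (differentiableAt_of_mem_disc hf (hmem t ht)).hasDerivAt.comp t h1
    exact h2.sub_const _
  have hBder : ∀ t ∈ Set.Icc (0 : ℝ) 1,
      HasDerivAt (fun t : ℝ => K * (Real.log (1 + t * ρ) - Real.log (1 - t * ρ)))
        (K * (ρ / (1 + t * ρ) + ρ / (1 - t * ρ))) t := fun t ht => by
    have h1 : 0 < 1 + t * ρ := by nlinarith [ht.1]
    have h2 : 0 < 1 - t * ρ := by nlinarith [ht.1, ht.2]
    have h3 := (((hasDerivAt_id t).mul_const ρ).const_add 1).log h1.ne'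
    have h4 := (((hasDerivAt_id t).mul_const ρ).const_sub 1).log h2.ne'
    have h5 := (h3.sub h4).const_mul K
    refine HasDerivAt.congr_deriv (f := fun t : ℝ =>
      K * (Real.log (1 + t * ρ) - Real.log (1 - t * ρ))) h5 ?_
    simp only [id, one_mul]; ring
  -- Along the radius to `w` the majorant has derivative `2ρK/(1-(tρ)²)`, twice what the Bloch bound
  -- requires.
  have hmain := image_norm_le_of_norm_deriv_right_le_deriv_boundary'
    (f := fun t : ℝ => f (t * w) - f 0) (f' := fun t : ℝ => deriv f (t * w) * w)
    (B := fun t : ℝ => K * (Real.log (1 + t * ρ) - Real.log (1 - t * ρ)))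
    (B' := fun t : ℝ => K * (ρ / (1 + t * ρ) + ρ / (1 - t * ρ))) (a := 0) (b := 1)
    (fun t ht => (hder t ht).continuousAt.continuousWithinAt)
    (fun t ht => (hder t (Set.Ico_subset_Icc_self ht)).hasDerivWithinAt)
    (by simp)
    (fun t ht => (hBder t ht).continuousAt.continuousWithinAt)
    (fun t ht => (hBder t (Set.Ico_subset_Icc_self ht)).hasDerivWithinAt)
    (fun t ht => by
      have ht' := Set.Ico_subset_Icc_self ht
      have hb := hK _ (hmem t ht')
      have h1 : 0 < 1 + t * ρ := by nlinarith [ht.1]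
      have h2 : 0 < 1 - t * ρ := by nlinarith [ht.1, ht.2]
      have e : ‖(t : ℂ) * w‖ = t * ρ := by
        rw [norm_mul, Complex.norm_real, Real.norm_of_nonneg ht.1]
      rw [e] at hb
      rw [norm_mul, ← hρ]
      have h3 : K * (ρ / (1 + t * ρ) + ρ / (1 - t * ρ)) = 2 * ρ * K / (1 - (t * ρ) ^ 2) := by
        have : 1 - (t * ρ) ^ 2 = (1 + t * ρ) * (1 - t * ρ) := by ring
        rw [this, div_add_div _ _ h1.ne' h2.ne', mul_div_assoc']
        congr 1; ring
      have h4 : 0 < 1 - (t * ρ) ^ 2 := by nlinarith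
      rw [h3, le_div_iff₀ h4]
      have h5 : 0 ≤ ‖deriv f (t * w)‖ * (1 - (t * ρ) ^ 2) := by positivity
      nlinarith)
  have h := hmain (x := 1) (by simp)
  simp only [Complex.ofReal_one, one_mul] at h
  rwa [← Real.log_div (by linarith) (by linarith)] at h

theorem enorm_le_of_bmoaIntegral_le {p : ℝ} (hp1 : 1 ≤ p) (hp2 : p ≤ 2) {f : ℂ → ℂ}
    (hf : DifferentiableOn ℂ f disc) {S : ℝ≥0∞} (hSt : S ≠ ∞)
    (hS : ∀ a ∈ disc, bmoaIntegral p f a ≤ S) {w : ℂ} (hw : w ∈ disc) :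
    ‖f w‖ₑ ≤ ‖f 0‖ₑ +
      6 * S ^ (1 / p) * ENNReal.ofReal (Real.log ((1 + ‖w‖) / (1 - ‖w‖))) := by
  have hT : 6 * S ^ (1 / p) ≠ ∞ :=
    ENNReal.mul_ne_top (by simp) (ENNReal.rpow_ne_top_of_nonneg (by positivity) hSt)
  set T := 6 * S ^ (1 / p) with hTdef
  have hK : ∀ b ∈ disc, ‖deriv f b‖ * (1 - ‖b‖ ^ 2) ≤ T.toReal := fun b hb => by
    have h := enorm_deriv_mul_le hp1 hp2 hf hS hb
    rw [← ofReal_norm, ← ENNReal.ofReal_mul (norm_nonneg _)] at h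
    exact (ENNReal.ofReal_le_iff_le_toReal hT).1 h
  have h := norm_sub_le_log_of_norm_deriv_le hf hK hw
  calc ‖f w‖ₑ = ‖f 0 + (f w - f 0)‖ₑ := by congr 1; ring
    _ ≤ ‖f 0‖ₑ + ‖f w - f 0‖ₑ := enorm_add_le _ _
    _ ≤ _ := by
      gcongr
      rw [← ofReal_norm, ← ENNReal.ofReal_toReal hT, ← ENNReal.ofReal_mul ENNReal.toReal_nonneg]
      exact ENNReal.ofReal_le_ofReal h

/-! ### Boundedness on `BMOA_p` -/

theorem iSup_bmoaIntegral_comp_le {p : ℝ} (hp1 : 1 ≤ p) (hp2 : p ≤ 2) {f ψ : ℂ → ℂ}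
    (hf : DifferentiableOn ℂ f disc) (hd : DifferentiableOn ℂ ψ disc)
    (hmaps : Set.MapsTo ψ disc disc) (hinj : Set.InjOn ψ disc) :
    ⨆ a ∈ disc, bmoaIntegral p (compOp ψ f) a ≤ 1332 * ⨆ a ∈ disc, bmoaIntegral p f a :=
  iSup₂_le fun _ ha => (bmoaIntegral_comp_le hp1 hp2 hf hd hmaps hinj ha).trans
    (mul_le_mul_right (le_iSup₂ (f := fun a (_ : a ∈ disc) => bmoaIntegral p f a) _ (hmaps ha)) _)

theorem bmoaNorm_comp_le {p : ℝ} (hp1 : 1 ≤ p) (hp2 : p ≤ 2) {f ψ : ℂ → ℂ} (hf : f ∈ BMOA p)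
    (hd : DifferentiableOn ℂ ψ disc) (hmaps : Set.MapsTo ψ disc disc)
    (hinj : Set.InjOn ψ disc) :
    bmoaNorm p (compOp ψ f) ≤
      ENNReal.ofReal (1400 * (1 + Real.log ((1 + ‖ψ 0‖) / (1 - ‖ψ 0‖)))) * bmoaNorm p f := by
  have hp0 : 0 < p := by linarith
  have hip : 0 ≤ 1 / p := by positivity
  have hip1 : 1 / p ≤ 1 := by rw [div_le_one hp0]; exact hp1
  set S := ⨆ a ∈ disc, bmoaIntegral p f a with hS
  set L := Real.log ((1 + ‖ψ 0‖) / (1 - ‖ψ 0‖)) with hL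
  have hψ0 : ‖ψ 0‖ < 1 := mem_disc.1 (hmaps zero_mem_disc)
  have hL0 : 0 ≤ L := Real.log_nonneg (by
    rw [le_div_iff₀ (by linarith)]; linarith [norm_nonneg (ψ 0)])
  have hval := enorm_le_of_bmoaIntegral_le hp1 hp2 hf.1 hf.2.ne
    (fun _ => le_iSup₂ (f := fun a (_ : a ∈ disc) => bmoaIntegral p f a) _)
    (hmaps zero_mem_disc)
  rw [← hS, ← hL] at hval
  have hN0 : ‖f 0‖ₑ ≤ bmoaNorm p f := by
    calc ‖f 0‖ₑ = (‖f 0‖ₑ ^ p) ^ (1 / p) := by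
          rw [← ENNReal.rpow_mul, mul_one_div_cancel hp0.ne', ENNReal.rpow_one]
      _ ≤ _ := ENNReal.rpow_le_rpow le_self_add hip
  have hNS : S ^ (1 / p) ≤ bmoaNorm p f := ENNReal.rpow_le_rpow le_add_self hip
  set N := bmoaNorm p f
  calc bmoaNorm p (compOp ψ f)
      ≤ (‖f (ψ 0)‖ₑ ^ p + 1332 * S) ^ (1 / p) := by
        rw [bmoaNorm]
        gcongr
        · exact le_rfl
        · exact iSup_bmoaIntegral_comp_le hp1 hp2 hf.1 hd hmaps hinj
    _ ≤ (‖f (ψ 0)‖ₑ ^ p) ^ (1 / p) + (1332 * S) ^ (1 / p) :=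
        ENNReal.rpow_add_le_add_rpow _ _ hip hip1
    _ = ‖f (ψ 0)‖ₑ + 1332 ^ (1 / p) * S ^ (1 / p) := by
        rw [← ENNReal.rpow_mul, mul_one_div_cancel hp0.ne', ENNReal.rpow_one,
          ENNReal.mul_rpow_of_nonneg _ _ hip]
    _ ≤ (N + 6 * N * ENNReal.ofReal L) + 1332 * N := by
        gcongr
        · exact hval.trans (by gcongr)
        · calc (1332 : ℝ≥0∞) ^ (1 / p) ≤ 1332 ^ (1 : ℝ) :=
              ENNReal.rpow_le_rpow_of_exponent_le (by norm_num) hip1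
            _ = 1332 := by simp
    _ = (1333 + 6 * ENNReal.ofReal L) * N := by ring
    -- A round number above both `1333 = 1 + 1332` and `6`.
    _ ≤ (1400 + 1400 * ENNReal.ofReal L) * N := by gcongr <;> norm_num
    _ = _ := by
        rw [ENNReal.ofReal_mul (by norm_num), ENNReal.ofReal_add zero_le_one hL0, mul_add]
        simp

theorem compOpNorm_le_of_subset {p : ℝ} (hp1 : 1 ≤ p) (hp2 : p ≤ 2) {ψ : ℂ → ℂ}
    (hd : DifferentiableOn ℂ ψ disc) (hmaps : Set.MapsTo ψ disc disc)
    (hinj : Set.InjOn ψ disc) {S : Set (ℂ → ℂ)} (hS : S ⊆ BMOA p) :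
    compOpNorm p S ψ ≤
      ENNReal.ofReal (1400 * (1 + Real.log ((1 + ‖ψ 0‖) / (1 - ‖ψ 0‖)))) :=
  sInf_le fun _ hf => bmoaNorm_comp_le hp1 hp2 (hS hf) hd hmaps hinj

theorem mapsTo_compOp_BMOA {p : ℝ} (hp1 : 1 ≤ p) (hp2 : p ≤ 2) {ψ : ℂ → ℂ}
    (hd : DifferentiableOn ℂ ψ disc) (hmaps : Set.MapsTo ψ disc disc)
    (hinj : Set.InjOn ψ disc) : Set.MapsTo (compOp ψ) (BMOA p) (BMOA p) := fun _ hf =>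
  ⟨hf.1.comp hd hmaps, (iSup_bmoaIntegral_comp_le hp1 hp2 hf.1 hd hmaps hinj).trans_lt
    (ENNReal.mul_lt_top (by simp) hf.2)⟩

/-! ### Vanishing at the boundary -/

theorem tendsto_comap_norm_zero_iff {X : ℂ → ℝ≥0∞} :
    Tendsto X (comap norm (𝓝[<] (1 : ℝ))) (𝓝 0) ↔
      ∀ ε : ℝ≥0∞, ε ≠ 0 → ∃ s < (1 : ℝ), ∀ a ∈ disc, s < ‖a‖ → X a ≤ ε := by
  have hb := ((nhdsLT_basis (1 : ℝ)).comap (norm : ℂ → ℝ))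
  rw [ENNReal.tendsto_nhds_zero]
  refine forall_congr' fun ε => ?_
  rw [hb.eventually_iff, gt_iff_lt, pos_iff_ne_zero]
  refine forall_congr' fun _ => exists_congr fun s => and_congr_right fun _ => ?_
  constructor
  · exact fun h a ha hs => h ⟨hs, mem_disc.1 ha⟩
  · exact fun h a ha => h a (mem_disc.2 ha.2) ha.1

theorem exists_lintegral_annulus_le {u : ℂ → ℝ≥0∞} (hu : Measurable u)
    (hfin : ∫⁻ z in disc, u z ≠ ∞) {ε : ℝ≥0∞} (hε : ε ≠ 0) :
    ∃ r, 0 ≤ r ∧ r < 1 ∧ ∫⁻ z in disc ∩ {z | r < ‖z‖}, u z ≤ ε := by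
  have hm : ∀ r : ℝ, MeasurableSet {z : ℂ | r < ‖z‖} := fun r =>
    measurableSet_lt measurable_const measurable_norm
  set ρ : ℕ → ℝ := fun n => 1 - 1 / ((n : ℝ) + 1) with hρ
  have hρt : Tendsto ρ atTop (𝓝 1) := by
    simpa [hρ] using tendsto_one_div_add_atTop_nhds_zero_nat.const_sub (1 : ℝ)
  have h := tendsto_lintegral_of_dominated_convergence (μ := volume.restrict disc)
    (F := fun n => {z : ℂ | ρ n < ‖z‖}.indicator u) (f := 0) u (fun n => hu.indicator (hm _))
    (fun n => Eventually.of_forall fun z => Set.indicator_le_self _ _ _) hfin (by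
      filter_upwards [ae_restrict_mem measurableSet_disc] with z hz
      refine tendsto_const_nhds.congr' ?_
      filter_upwards [hρt.eventually (lt_mem_nhds (mem_disc.1 hz))] with n hn
      rw [Set.indicator_of_notMem (by simpa using hn.le), Pi.zero_apply])
  simp only [Pi.zero_apply, lintegral_zero] at h
  obtain ⟨n, hn⟩ := ((ENNReal.tendsto_nhds_zero.1 h) ε (pos_iff_ne_zero.2 hε)).exists
  have h1 : 1 / ((n : ℝ) + 1) ≤ 1 := by
    rw [div_le_one (by positivity)]; linarith [n.cast_nonneg (α := ℝ)]
  have h2 : 0 < 1 / ((n : ℝ) + 1) := by positivity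
  refine ⟨ρ n, by simp only [hρ]; linarith, by simp only [hρ]; linarith, ?_⟩
  rwa [lintegral_indicator (hm _), Measure.restrict_restrict (hm _), Set.inter_comm] at hn

theorem enorm_mul_enorm_le (x y : ℂ) {η : ℝ} (hη : 0 < η) :
    ‖x‖ₑ * ‖y‖ₑ ≤ ENNReal.ofReal η * ‖y‖ₑ ^ 2 + ENNReal.ofReal η⁻¹ * ‖x‖ₑ ^ 2 := by
  rw [← ofReal_norm, ← ofReal_norm, ← ENNReal.ofReal_pow (norm_nonneg _),
    ← ENNReal.ofReal_pow (norm_nonneg _), ← ENNReal.ofReal_mul (norm_nonneg _),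
    ← ENNReal.ofReal_mul hη.le, ← ENNReal.ofReal_mul (by positivity),
    ← ENNReal.ofReal_add (by positivity) (by positivity)]
  refine ENNReal.ofReal_le_ofReal ?_
  have e : η * ‖y‖ ^ 2 + η⁻¹ * ‖x‖ ^ 2 - ‖x‖ * ‖y‖ =
      η⁻¹ * ((η * ‖y‖ - ‖x‖ / 2) ^ 2 + 3 / 4 * ‖x‖ ^ 2) := by
    field_simp; ring
  have : 0 ≤ η⁻¹ * ((η * ‖y‖ - ‖x‖ / 2) ^ 2 + 3 / 4 * ‖x‖ ^ 2) := by positivity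
  linarith

theorem volume_disc : volume disc = ENNReal.ofReal Real.pi := by
  rw [disc, Complex.volume_ball]
  simp only [ENNReal.ofReal_one, one_pow, one_mul]
  exact (ENNReal.ofReal_coe_nnreal (p := NNReal.pi)).symm

theorem lintegral_enorm_deriv_sq_le {ψ : ℂ → ℂ} (hd : DifferentiableOn ℂ ψ disc)
    (hmaps : Set.MapsTo ψ disc disc) (hinj : Set.InjOn ψ disc) :
    ∫⁻ z in disc, ‖deriv ψ z‖ₑ ^ 2 ≤ ENNReal.ofReal Real.pi := by
  rw [lintegral_enorm_deriv_sq_eq_volume_image measurableSet_disc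
    (fun z hz => differentiableAt_of_mem_disc hd hz) hinj, ← volume_disc]
  exact measure_mono hmaps.image_subset

theorem norm_deriv_mobius_le {a z : ℂ} (ha : a ∈ disc) (hz : z ∈ disc) :
    ‖deriv (mobius a) z‖ ≤ (1 - ‖a‖ ^ 2) / (1 - ‖a‖ * ‖z‖) ^ 2 := by
  rw [norm_deriv_mobius ha hz]
  have h1 : 0 < 1 - ‖a‖ * ‖z‖ := by
    rw [mem_disc] at ha hz; nlinarith [norm_nonneg a, norm_nonneg z]
  have h2 : 1 - ‖a‖ * ‖z‖ ≤ ‖1 - (starRingEnd ℂ) a * z‖ := by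
    have := norm_sub_norm_le 1 ((starRingEnd ℂ) a * z)
    rwa [norm_one, norm_mul, RCLike.norm_conj] at this
  have := one_sub_norm_sq_pos ha
  gcongr

theorem le_norm_deriv_mobius {a z : ℂ} (ha : a ∈ disc) (hz : z ∈ disc) :
    (1 - ‖a‖ ^ 2) / 4 ≤ ‖deriv (mobius a) z‖ := by
  rw [norm_deriv_mobius ha hz]
  have h0 : 0 < ‖1 - (starRingEnd ℂ) a * z‖ := norm_pos_iff.2 (one_sub_conj_mul_ne_zero ha hz)
  have h2 : ‖1 - (starRingEnd ℂ) a * z‖ ≤ 2 := by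
    have := norm_sub_le 1 ((starRingEnd ℂ) a * z)
    rw [norm_one, norm_mul, RCLike.norm_conj] at this
    rw [mem_disc] at ha hz
    nlinarith [norm_nonneg a, norm_nonneg z]
  have := (one_sub_norm_sq_pos ha).le
  gcongr
  nlinarith

theorem norm_deriv_mobius_le_of_norm_le {a z : ℂ} {ρ : ℝ} (ha : a ∈ disc) (hz : z ∈ disc)
    (hρ : ρ < 1) (haρ : ‖a‖ ≤ ρ) : ‖deriv (mobius a) z‖ ≤ 1 / (1 - ρ) ^ 2 := by
  refine (norm_deriv_mobius_le ha hz).trans ?_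
  have h1 : 1 - ρ ≤ 1 - ‖a‖ * ‖z‖ := by
    rw [mem_disc] at ha hz; nlinarith [norm_nonneg a, norm_nonneg z]
  have h2 : 0 < 1 - ρ := by linarith
  have h3 : 1 - ‖a‖ ^ 2 ≤ 1 := by linarith [sq_nonneg ‖a‖]
  gcongr

/-- A weak Schwarz–Pick inequality: Cauchy's estimate with radius tending to `1-|z|`, then `1+|z| ≤
2`. -/
theorem norm_deriv_mul_le_two {ψ : ℂ → ℂ} (hd : DifferentiableOn ℂ ψ disc)
    (hmaps : Set.MapsTo ψ disc disc) {z : ℂ} (hz : z ∈ disc) :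
    ‖deriv ψ z‖ * (1 - ‖z‖ ^ 2) ≤ 2 := by
  have hz1 := mem_disc.1 hz
  have h : ∀ r, 0 < r → r < 1 - ‖z‖ → ‖deriv ψ z‖ * r ≤ 1 := fun r hr0 hr => by
    have hball : Metric.closedBall z r ⊆ disc := fun w hw => by
      rw [Metric.mem_closedBall, dist_eq_norm] at hw
      have : ‖w‖ ≤ ‖z‖ + ‖w - z‖ := by simpa using norm_add_le z (w - z)
      exact mem_disc.2 (by linarith)
    have h := Complex.norm_deriv_le_of_forall_mem_sphere_norm_le (C := 1) hr0
      ((hd.mono (Metric.closure_ball_subset_closedBall.trans hball)).diffContOnCl)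
      (fun w hw => (mem_disc.1 (hmaps (hball (Metric.sphere_subset_closedBall hw)))).le)
    rwa [le_div_iff₀ hr0] at h
  have h2 : ‖deriv ψ z‖ * (1 - ‖z‖) ≤ 1 := by
    have ht : Tendsto (fun r => ‖deriv ψ z‖ * r) (𝓝[<] (1 - ‖z‖)) (𝓝 (‖deriv ψ z‖ * (1 - ‖z‖))) :=
      (continuous_const.mul continuous_id).continuousAt.tendsto.mono_left nhdsWithin_le_nhds
    refine le_of_tendsto ht ?_
    filter_upwards [Ioo_mem_nhdsLT (show 0 < 1 - ‖z‖ by linarith)] with r hr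
    exact h r hr.1 hr.2
  nlinarith [norm_nonneg z, mul_nonneg (norm_nonneg (deriv ψ z)) (sub_nonneg.2 hz1.le)]

/-- Removing the factor `(|ψ'|(1-|z|²))^(p-1) ≤ 2` reduces every `p` to the case `p = 1`. -/
theorem bmoaIntegral_le_of_selfMap {p : ℝ} (hp1 : 1 ≤ p) (hp2 : p ≤ 2) {ψ : ℂ → ℂ}
    (hd : DifferentiableOn ℂ ψ disc) (hmaps : Set.MapsTo ψ disc disc) {a : ℂ} (ha : a ∈ disc) :
    bmoaIntegral p ψ a ≤ ENNReal.ofReal (1 / Real.pi) *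
      (2 * ∫⁻ z in disc, ‖deriv ψ z‖ₑ * ‖deriv (mobius a) z‖ₑ) := by
  rw [bmoaIntegral, area, lintegral_smul_measure, smul_eq_mul,
    ← lintegral_const_mul' 2 _ (by simp)]
  refine mul_le_mul_right (setLIntegral_mono' measurableSet_disc fun z hz => ?_) _
  have h1 := one_sub_norm_sq_pos hz
  rw [one_sub_norm_mobius_sq' ha hz, ← ofReal_norm, ← ofReal_norm,
    ENNReal.ofReal_rpow_of_nonneg (norm_nonneg _) (by linarith), ← ENNReal.ofReal_mul (by positivity),
    ← ENNReal.ofReal_mul (norm_nonneg _), show (2 : ℝ≥0∞) = ENNReal.ofReal 2 by simp,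
    ← ENNReal.ofReal_mul (by norm_num)]
  refine ENNReal.ofReal_le_ofReal ?_
  have e1 : (1 - ‖z‖ ^ 2) ^ (p - 2) * (1 - ‖z‖ ^ 2) = (1 - ‖z‖ ^ 2) ^ (p - 1) := by
    rw [← Real.rpow_add_one h1.ne']; congr 1; ring
  have e2 : ‖deriv ψ z‖ ^ p = ‖deriv ψ z‖ ^ (p - 1) * ‖deriv ψ z‖ := by
    rcases eq_or_ne ‖deriv ψ z‖ 0 with h0 | h0
    · rw [h0, Real.zero_rpow (by linarith)]; simp
    · rw [← Real.rpow_add_one h0]; congr 1; ring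
  have h2 : (‖deriv ψ z‖ * (1 - ‖z‖ ^ 2)) ^ (p - 1) ≤ 2 :=
    calc _ ≤ (2 : ℝ) ^ (p - 1) := Real.rpow_le_rpow (by positivity)
          (norm_deriv_mul_le_two hd hmaps hz) (by linarith)
      _ ≤ 2 ^ (1 : ℝ) := Real.rpow_le_rpow_of_exponent_le (by norm_num) (by linarith)
      _ = 2 := by simp
  rw [← mul_assoc ((1 - ‖z‖ ^ 2) ^ (p - 2)), e1, e2]
  rw [Real.mul_rpow (norm_nonneg _) h1.le] at h2
  calc _ = (‖deriv ψ z‖ ^ (p - 1) * (1 - ‖z‖ ^ 2) ^ (p - 1)) *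
        (‖deriv ψ z‖ * ‖deriv (mobius a) z‖) := by ring
    _ ≤ _ := by gcongr

/-- On `|z| ≤ r` the derivative of `φ_a` is uniformly small as `|a| → 1`. On the annulus the
weighted AM-GM inequality is used: `∫ |φ_a'|²` is at most `π`, and the tail of `∫ |ψ'|²` can be made
small against `η⁻¹`. -/
theorem lintegral_enorm_deriv_mul_mobius_le {ψ : ℂ → ℂ} (hd : DifferentiableOn ℂ ψ disc)
    (hmaps : Set.MapsTo ψ disc disc) (hinj : Set.InjOn ψ disc) {a : ℂ} (ha : a ∈ disc) {r η : ℝ}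
    (hr1 : r < 1) (hη : 0 < η) :
    ∫⁻ z in disc, ‖deriv ψ z‖ₑ * ‖deriv (mobius a) z‖ₑ ≤
      ENNReal.ofReal (2 * Real.pi * ((1 - ‖a‖ ^ 2) / (1 - r) ^ 2)) + (ENNReal.ofReal (η * Real.pi) +
        ENNReal.ofReal η⁻¹ * ∫⁻ z in disc ∩ {z | r < ‖z‖}, ‖deriv ψ z‖ₑ ^ 2) := by
  have hm : MeasurableSet {z : ℂ | r < ‖z‖} := measurableSet_lt measurable_const measurable_norm
  rw [← lintegral_inter_add_sdiff _ disc hm, add_comm]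
  have hψ := lintegral_enorm_deriv_sq_le hd hmaps hinj
  have hφ := lintegral_enorm_deriv_sq_le (differentiableOn_mobius ha) (mapsTo_mobius ha)
    (injOn_mobius ha)
  have ha0 := one_sub_norm_sq_pos ha
  gcongr
  · have hpt : ∀ z ∈ disc \ {z | r < ‖z‖}, ‖deriv ψ z‖ₑ * ‖deriv (mobius a) z‖ₑ ≤
        ENNReal.ofReal ((1 - ‖a‖ ^ 2) / (1 - r) ^ 2) * (1 + ‖deriv ψ z‖ₑ ^ 2) := fun z hz => by
      rw [mul_comm]
      gcongr
      · rw [← ofReal_norm]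
        refine ENNReal.ofReal_le_ofReal ((norm_deriv_mobius_le ha hz.1).trans ?_)
        have hzr : ‖z‖ ≤ r := by simpa using hz.2
        have h1 : 1 - r ≤ 1 - ‖a‖ * ‖z‖ := by
          have := mem_disc.1 ha; nlinarith [norm_nonneg a, norm_nonneg z]
        have h2 : 0 < 1 - r := by linarith
        gcongr
      · simpa using rpow_le_one_add_sq ‖deriv ψ z‖ₑ zero_le_one one_le_two
    refine (setLIntegral_mono' (measurableSet_disc.diff hm) hpt).trans ?_
    refine (lintegral_mono_set Set.sdiff_subset).trans ?_
    rw [lintegral_const_mul' _ _ ENNReal.ofReal_ne_top, lintegral_add_left measurable_const,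
      lintegral_const, Measure.restrict_apply_univ, volume_disc, one_mul]
    calc _ ≤ ENNReal.ofReal ((1 - ‖a‖ ^ 2) / (1 - r) ^ 2) *
          (ENNReal.ofReal Real.pi + ENNReal.ofReal Real.pi) := by gcongr
      _ = _ := by
        rw [← ENNReal.ofReal_add Real.pi_pos.le Real.pi_pos.le,
          ← ENNReal.ofReal_mul (by positivity)]
        congr 1; ring
  · calc ∫⁻ z in disc ∩ {z | r < ‖z‖}, ‖deriv ψ z‖ₑ * ‖deriv (mobius a) z‖ₑ
        ≤ ∫⁻ z in disc ∩ {z | r < ‖z‖}, (ENNReal.ofReal η * ‖deriv (mobius a) z‖ₑ ^ 2 +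
            ENNReal.ofReal η⁻¹ * ‖deriv ψ z‖ₑ ^ 2) :=
          lintegral_mono fun z => enorm_mul_enorm_le _ _ hη
      _ = ENNReal.ofReal η * (∫⁻ z in disc ∩ {z | r < ‖z‖}, ‖deriv (mobius a) z‖ₑ ^ 2) +
            ENNReal.ofReal η⁻¹ * ∫⁻ z in disc ∩ {z | r < ‖z‖}, ‖deriv ψ z‖ₑ ^ 2 := by
          rw [lintegral_add_left (((measurable_deriv _).enorm.pow_const 2).const_mul _),
            lintegral_const_mul' _ _ ENNReal.ofReal_ne_top,
            lintegral_const_mul' _ _ ENNReal.ofReal_ne_top]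
      _ ≤ _ := by
          rw [ENNReal.ofReal_mul hη.le]
          gcongr
          exact (lintegral_mono_set Set.inter_subset_left).trans hφ

theorem exists_bmoaIntegral_selfMap_le {p : ℝ} (hp1 : 1 ≤ p) (hp2 : p ≤ 2) {ψ : ℂ → ℂ}
    (hd : DifferentiableOn ℂ ψ disc) (hmaps : Set.MapsTo ψ disc disc) (hinj : Set.InjOn ψ disc)
    {ε : ℝ≥0∞} (hε : ε ≠ 0) :
    ∃ s < (1 : ℝ), ∀ a ∈ disc, s < ‖a‖ → bmoaIntegral p ψ a ≤ ε := by
  have hπ := Real.pi_pos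
  obtain ⟨η, hη0, hηε⟩ : ∃ η : ℝ, 0 < η ∧ ENNReal.ofReal (6 * η) ≤ ε := by
    rcases eq_or_ne ε ∞ with rfl | hεt
    · exact ⟨1, one_pos, le_top⟩
    · refine ⟨ε.toReal / 6, by have := ENNReal.toReal_pos hε hεt; positivity, ?_⟩
      rw [mul_div_cancel₀ _ (by norm_num), ENNReal.ofReal_toReal hεt]
  -- The extra `η` in the tail bound compensates the later `η⁻¹`. Each of the three terms is then at
  -- most `ηπ`, and the prefactor `2/π` makes the total `6η`.
  obtain ⟨r, hr0, hr1, hr⟩ := exists_lintegral_annulus_le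
    ((measurable_deriv ψ).enorm.pow_const 2)
    ((lintegral_enorm_deriv_sq_le hd hmaps hinj).trans_lt ENNReal.ofReal_lt_top).ne
    (ε := ENNReal.ofReal (η * (η * Real.pi)))
    (by simp only [ne_eq, ENNReal.ofReal_eq_zero, not_le]; positivity)
  have hr2 : 0 < 1 - r := by linarith
  refine ⟨1 - η * (1 - r) ^ 2 / 4, by
    have : 0 < η * (1 - r) ^ 2 / 4 := by positivity
    linarith, fun a ha has => ?_⟩
  have ha1 : 2 * Real.pi * ((1 - ‖a‖ ^ 2) / (1 - r) ^ 2) ≤ η * Real.pi := by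
    have h1 : 1 - ‖a‖ ^ 2 ≤ η * (1 - r) ^ 2 / 2 := by
      have := mem_disc.1 ha
      nlinarith [norm_nonneg a]
    have h2 : (1 - ‖a‖ ^ 2) / (1 - r) ^ 2 ≤ η / 2 := by
      rw [div_le_iff₀ (by positivity)]; linarith
    nlinarith
  calc bmoaIntegral p ψ a ≤ _ := bmoaIntegral_le_of_selfMap hp1 hp2 hd hmaps ha
    _ ≤ ENNReal.ofReal (1 / Real.pi) * (2 *
        (ENNReal.ofReal (η * Real.pi) + (ENNReal.ofReal (η * Real.pi) +
          ENNReal.ofReal η⁻¹ * ENNReal.ofReal (η * (η * Real.pi))))) := by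
        gcongr
        refine (lintegral_enorm_deriv_mul_mobius_le hd hmaps hinj ha hr1 hη0).trans ?_
        gcongr
    _ = ENNReal.ofReal (6 * η) := by
        rw [← ENNReal.ofReal_mul (by positivity), inv_mul_cancel_left₀ hη0.ne',
          ← ENNReal.ofReal_add (by positivity) (by positivity),
          ← ENNReal.ofReal_add (by positivity) (by positivity),
          show (2 : ℝ≥0∞) = ENNReal.ofReal 2 by simp, ← ENNReal.ofReal_mul (by positivity),
          ← ENNReal.ofReal_mul (by positivity)]
        congr 1; field_simp; norm_num
    _ ≤ ε := hηε

theorem bmoa_weight_eq {p : ℝ} {a z : ℂ} (ha : a ∈ disc) (hz : z ∈ disc) :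
    (1 - ‖z‖ ^ 2) ^ (p - 2) * (1 - ‖mobius a z‖ ^ 2) =
      (1 - ‖z‖ ^ 2) ^ (p - 1) * ‖deriv (mobius a) z‖ := by
  have h1 := one_sub_norm_sq_pos hz
  rw [one_sub_norm_mobius_sq' ha hz, ← mul_assoc, ← Real.rpow_add_one h1.ne']
  congr 2; ring

theorem bmoaIntegral_zero_eq (p : ℝ) (f : ℂ → ℂ) :
    bmoaIntegral p f 0 = ENNReal.ofReal (1 / Real.pi) * dirichletIntegral p f := by
  rw [bmoaIntegral, area, lintegral_smul_measure, smul_eq_mul, dirichletIntegral]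
  congr 1
  refine setLIntegral_congr_fun measurableSet_disc fun z hz => ?_
  rw [bmoa_weight_eq zero_mem_disc hz, norm_deriv_mobius zero_mem_disc hz]
  simp

theorem dirichletIntegral_ne_top {p : ℝ} {f : ℂ → ℂ} (hf : f ∈ BMOA p) :
    dirichletIntegral p f ≠ ∞ := by
  have h : bmoaIntegral p f 0 < ∞ :=
    (le_iSup₂ (f := fun a (_ : a ∈ disc) => bmoaIntegral p f a) 0 zero_mem_disc).trans_lt hf.2
  rw [bmoaIntegral_zero_eq] at h
  intro htop
  rw [htop, ENNReal.mul_top (by simpa using Real.pi_pos)] at h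
  exact lt_irrefl _ h

/-- The part of the Dirichlet type integral of `f ∘ φ_b` near the unit circle is controlled by the
corresponding part for `f`, locally uniformly in `b`. -/
theorem lintegral_annulus_comp_mobius_le {p : ℝ} (hp : 0 ≤ p) {f : ℂ → ℂ}
    (hf : DifferentiableOn ℂ f disc) {b : ℂ} (hb : b ∈ disc) {ρ r t : ℝ} (hρ : ρ < 1)
    (hbρ : ‖b‖ ≤ ρ) (ht : 8 * t ≤ (1 - r) * (1 - ρ)) :
    ∫⁻ z in disc ∩ {z | 1 - ‖z‖ < t},
        ‖deriv (f ∘ mobius b) z‖ₑ ^ p * ENNReal.ofReal ((1 - ‖z‖ ^ 2) ^ (p - 1)) ≤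
      ENNReal.ofReal (1 / (1 - ρ) ^ 2) * ∫⁻ z in disc ∩ {z | r < ‖z‖},
        ‖deriv f z‖ₑ ^ p * ENNReal.ofReal ((1 - ‖z‖ ^ 2) ^ (p - 1)) := by
  have hm : MeasurableSet {z : ℂ | r < ‖z‖} := measurableSet_lt measurable_const measurable_norm
  have hmt : MeasurableSet {z : ℂ | 1 - ‖z‖ < t} :=
    measurableSet_lt (measurable_const.sub measurable_norm) measurable_const
  have h := lintegral_mobius_weight_eq hp hf hb ({z : ℂ | 1 - ‖z‖ < t}.indicator 1)
  have e : ∫⁻ z in disc ∩ {z | 1 - ‖z‖ < t},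
        ‖deriv (f ∘ mobius b) z‖ₑ ^ p * ENNReal.ofReal ((1 - ‖z‖ ^ 2) ^ (p - 1)) =
      ∫⁻ z in disc, ‖deriv (f ∘ mobius b) z‖ₑ ^ p * ENNReal.ofReal ((1 - ‖z‖ ^ 2) ^ (p - 1)) *
        {z : ℂ | 1 - ‖z‖ < t}.indicator 1 z := by
    rw [Set.inter_comm, ← Measure.restrict_restrict hmt, ← lintegral_indicator hmt]
    refine lintegral_congr fun z => ?_
    by_cases hz : z ∈ {z : ℂ | 1 - ‖z‖ < t} <;> simp only [hz, Set.indicator_of_mem,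
      not_false_eq_true, Set.indicator_of_notMem, Pi.one_apply, mul_one, mul_zero]
  rw [e, ← h, ← lintegral_const_mul' _ _ ENNReal.ofReal_ne_top, Set.inter_comm disc,
    ← Measure.restrict_restrict hm, ← lintegral_indicator hm]
  refine setLIntegral_mono' measurableSet_disc fun z hz => ?_
  by_cases hzt : 1 - ‖mobius b z‖ < t
  swap
  · rw [Set.indicator_of_notMem (by simpa using hzt), mul_zero]; exact zero_le
  have h1 := one_sub_norm_sq_pos hz
  -- Since `|φ_b'| ≥ (1-ρ)/4`, one has `(1-|z|²)(1-ρ)/4 ≤ 1-|φ_b(z)|² < 2t`; the hypothesis on `8t`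
  -- then gives `|z|² > r`.
  have hzr : r < ‖z‖ := by
    have h2 := one_sub_norm_mobius_sq' hb hz
    have h3 := le_norm_deriv_mobius hb hz
    have h4 := mem_disc.1 (mobius_mem_disc hb hz)
    have h5 : 1 - ‖mobius b z‖ ^ 2 < 2 * t := by nlinarith [norm_nonneg (mobius b z)]
    have h6 : 1 - ρ ≤ 1 - ‖b‖ ^ 2 := by nlinarith [norm_nonneg b, mem_disc.1 hb]
    have h7 : (1 - ‖z‖ ^ 2) * ((1 - ρ) / 4) ≤ (1 - ‖z‖ ^ 2) * ‖deriv (mobius b) z‖ := by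
      gcongr; linarith
    have h8 : (1 - ‖z‖ ^ 2) * (1 - ρ) < (1 - r) * (1 - ρ) := by nlinarith
    have h9 : 1 - ‖z‖ ^ 2 < 1 - r := lt_of_mul_lt_mul_right h8 (by linarith)
    nlinarith [norm_nonneg z, mem_disc.1 hz]
  rw [Set.indicator_of_mem (show mobius b z ∈ {z : ℂ | 1 - ‖z‖ < t} from hzt),
    Set.indicator_of_mem (show z ∈ {z : ℂ | r < ‖z‖} from hzr), Pi.one_apply, mul_one,
    mul_left_comm, ← ENNReal.ofReal_mul (by positivity), bmoa_weight_eq hb hz]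
  refine mul_le_mul_right (ENNReal.ofReal_le_ofReal ?_) _
  rw [mul_comm]
  gcongr
  exact norm_deriv_mobius_le_of_norm_le hb hz hρ hbρ

theorem bmoaIntegral_mobius_comp_le {p : ℝ} (hp : 0 ≤ p) {ψ : ℂ → ℂ}
    (hd : DifferentiableOn ℂ ψ disc) (hmaps : Set.MapsTo ψ disc disc) {b : ℂ} (hb : b ∈ disc)
    {ρ : ℝ} (hρ : ρ < 1) (hbρ : ‖b‖ ≤ ρ) (a : ℂ) :
    bmoaIntegral p (mobius b ∘ ψ) a ≤
      ENNReal.ofReal (1 / (1 - ρ) ^ 2) ^ p * bmoaIntegral p ψ a := by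
  rw [bmoaIntegral, bmoaIntegral, ← lintegral_const_mul' _ _
    (ENNReal.rpow_ne_top_of_nonneg hp ENNReal.ofReal_ne_top), area, lintegral_smul_measure,
    lintegral_smul_measure]
  refine mul_le_mul_right (setLIntegral_mono' measurableSet_disc fun z hz => ?_) _
  rw [enorm_deriv_comp_rpow hp (differentiableOn_mobius hb) hd hmaps hz, mul_assoc]
  gcongr
  rw [← ofReal_norm]
  exact ENNReal.ofReal_le_ofReal (norm_deriv_mobius_le_of_norm_le hb (hmaps hz) hρ hbρ)

/-- The contribution to the Dirichlet type integral of `F ∘ ψ` of the points which `ψ` keeps away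
from the unit circle. -/
theorem lintegral_comp_away_le {p : ℝ} (hp1 : 1 ≤ p) (hp2 : p ≤ 2) {F ψ : ℂ → ℂ}
    (hF : DifferentiableOn ℂ F disc) {S : ℝ≥0∞} (hS : ∀ a ∈ disc, bmoaIntegral p F a ≤ S)
    (hd : DifferentiableOn ℂ ψ disc) (hmaps : Set.MapsTo ψ disc disc) {t : ℝ} (ht : 0 < t) :
    ∫⁻ z in disc \ {z | 1 - ‖ψ z‖ < t},
        ‖deriv (F ∘ ψ) z‖ₑ ^ p * ENNReal.ofReal ((1 - ‖z‖ ^ 2) ^ (p - 1)) ≤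
      (6 * S ^ (1 / p) * ENNReal.ofReal t⁻¹) ^ p * dirichletIntegral p ψ := by
  have hp0 : 0 ≤ p := by linarith
  have hopen : IsOpen (disc ∩ {z | 1 - ‖ψ z‖ < t}) :=
    (continuousOn_const.sub hd.continuousOn.norm).isOpen_inter_preimage isOpen_disc isOpen_Iio
  have hm : MeasurableSet (disc \ {z | 1 - ‖ψ z‖ < t}) := by
    rw [← Set.sdiff_self_inter]; exact measurableSet_disc.diff hopen.measurableSet
  have hpt : ∀ z ∈ disc \ {z | 1 - ‖ψ z‖ < t},
      ‖deriv (F ∘ ψ) z‖ₑ ^ p * ENNReal.ofReal ((1 - ‖z‖ ^ 2) ^ (p - 1)) ≤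
      (6 * S ^ (1 / p) * ENNReal.ofReal t⁻¹) ^ p *
        (‖deriv ψ z‖ₑ ^ p * ENNReal.ofReal ((1 - ‖z‖ ^ 2) ^ (p - 1))) := fun z hz => by
    rw [enorm_deriv_comp_rpow hp0 hF hd hmaps hz.1, mul_assoc]
    gcongr
    have hw := hmaps hz.1
    have h := enorm_deriv_mul_le hp1 hp2 hF hS hw
    have h1 : t ≤ 1 - ‖ψ z‖ ^ 2 := by
      have h2 : t ≤ 1 - ‖ψ z‖ := by simpa using hz.2
      have := mem_disc.1 hw
      nlinarith [norm_nonneg (ψ z)]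
    calc ‖deriv F (ψ z)‖ₑ = ‖deriv F (ψ z)‖ₑ * ENNReal.ofReal t * ENNReal.ofReal t⁻¹ := by
          rw [mul_assoc, ← ENNReal.ofReal_mul ht.le, mul_inv_cancel₀ ht.ne']; simp
      _ ≤ ‖deriv F (ψ z)‖ₑ * ENNReal.ofReal (1 - ‖ψ z‖ ^ 2) * ENNReal.ofReal t⁻¹ := by gcongr
      _ ≤ _ := by gcongr
  refine (setLIntegral_mono' hm hpt).trans ((lintegral_mono_set Set.sdiff_subset).trans ?_)
  by_cases hc : (6 * S ^ (1 / p) * ENNReal.ofReal t⁻¹) ^ p = ∞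
  · rw [dirichletIntegral, lintegral_const_mul]
    exact ((measurable_deriv ψ).enorm.pow_const p).mul
      (((measurable_const.sub (measurable_norm.pow_const 2)).pow_const (p - 1)).ennreal_ofReal)
  · rw [dirichletIntegral, lintegral_const_mul' _ _ hc]

theorem dirichletIntegral_comp_le_add {p : ℝ} (hp1 : 1 ≤ p) (hp2 : p ≤ 2) {F ψ : ℂ → ℂ}
    (hF : DifferentiableOn ℂ F disc) {S : ℝ≥0∞} (hS : ∀ a ∈ disc, bmoaIntegral p F a ≤ S)
    (hd : DifferentiableOn ℂ ψ disc) (hmaps : Set.MapsTo ψ disc disc)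
    (hinj : Set.InjOn ψ disc) (h0 : ψ 0 = 0) {t : ℝ} (ht : 0 < t) :
    dirichletIntegral p (F ∘ ψ) ≤
      1332 * (∫⁻ ζ in disc ∩ {ζ | 1 - ‖ζ‖ < 2 * t},
        ‖deriv F ζ‖ₑ ^ p * ENNReal.ofReal ((1 - ‖ζ‖ ^ 2) ^ (p - 1))) +
      (6 * S ^ (1 / p) * ENNReal.ofReal t⁻¹) ^ p * dirichletIntegral p ψ := by
  have hopen : IsOpen (disc ∩ {z | 1 - ‖ψ z‖ < t}) :=
    (continuousOn_const.sub hd.continuousOn.norm).isOpen_inter_preimage isOpen_disc isOpen_Iio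
  have h1 := lintegral_comp_weight_le hp1 hp2 (measurable_deriv F) (differentiableOn_deriv hF)
    hd hmaps hinj h0 t
  have h2 := lintegral_comp_away_le hp1 hp2 hF hS hd hmaps ht
  have h3 : ∫⁻ z in disc ∩ {z | 1 - ‖ψ z‖ < t},
        ‖deriv (F ∘ ψ) z‖ₑ ^ p * ENNReal.ofReal ((1 - ‖z‖ ^ 2) ^ (p - 1)) =
      ∫⁻ z in disc ∩ {z | 1 - ‖ψ z‖ < t}, ‖deriv F (ψ z)‖ₑ ^ p *
        (‖deriv ψ z‖ₑ ^ p * ENNReal.ofReal ((1 - ‖z‖ ^ 2) ^ (p - 1))) :=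
    setLIntegral_congr_fun hopen.measurableSet fun z hz => by
      simp only [enorm_deriv_comp_rpow (zero_le_one.trans hp1) hF hd hmaps hz.1, mul_assoc]
  rw [dirichletIntegral]
  conv_lhs => rw [← Set.inter_union_sdiff disc {z | 1 - ‖ψ z‖ < t}]
  exact (lintegral_union_le _ _ _).trans (add_le_add (h3.le.trans h1) h2)

/-- Membership of `f` in `BMOA_p` suffices here, the decay coming from `ψ`. The choices depend in
turn on the earlier ones: `r` from the tail of `D_p(f)`, then `t`, then the constant `N`, then `s`.
All are uniform over `b = ψ(a)` with `|b| ≤ ρ`. -/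
theorem exists_bmoaIntegral_comp_le {p : ℝ} (hp1 : 1 ≤ p) (hp2 : p ≤ 2) {f ψ : ℂ → ℂ}
    (hf : f ∈ BMOA p) (hd : DifferentiableOn ℂ ψ disc) (hmaps : Set.MapsTo ψ disc disc)
    (hinj : Set.InjOn ψ disc) {ρ : ℝ} (hρ : ρ < 1) {ε : ℝ≥0∞} (hε : ε ≠ 0) :
    ∃ s < (1 : ℝ), ∀ a ∈ disc, s < ‖a‖ → ‖ψ a‖ ≤ ρ → bmoaIntegral p (compOp ψ f) a ≤ ε := by
  have hp0 : 0 ≤ p := by linarith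
  have hε2 : ε / 2 ≠ 0 := (ENNReal.half_pos hε).ne'
  -- The composition bound for the univalent map `φ_b` itself makes `S` serve for every `f ∘ φ_b` at
  -- once.
  set S := 1332 * ⨆ a ∈ disc, bmoaIntegral p f a with hSdef
  have hSt : S ≠ ∞ := ENNReal.mul_ne_top (by simp) hf.2.ne
  have hS : ∀ b ∈ disc, ∀ a ∈ disc, bmoaIntegral p (f ∘ mobius b) a ≤ S := fun b hb a ha =>
    (le_iSup₂ (f := fun a (_ : a ∈ disc) => bmoaIntegral p (compOp (mobius b) f) a) a ha).trans
      (iSup_bmoaIntegral_comp_le hp1 hp2 hf.1 (differentiableOn_mobius hb) (mapsTo_mobius hb)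
        (injOn_mobius hb))
  set M : ℝ≥0∞ := ENNReal.ofReal (1 / (1 - ρ) ^ 2)
  set c : ℝ≥0∞ := ENNReal.ofReal (1 / Real.pi) * (1332 * M) with hc
  have hct : c ≠ ∞ := ENNReal.mul_ne_top ENNReal.ofReal_ne_top
    (ENNReal.mul_ne_top (by simp) ENNReal.ofReal_ne_top)
  obtain ⟨r, -, hr1, hr⟩ := exists_lintegral_annulus_le
    (u := fun z => ‖deriv f z‖ₑ ^ p * ENNReal.ofReal ((1 - ‖z‖ ^ 2) ^ (p - 1)))
    (((measurable_deriv f).enorm.pow_const p).mul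
      (((measurable_const.sub (measurable_norm.pow_const 2)).pow_const (p - 1)).ennreal_ofReal))
    (dirichletIntegral_ne_top hf) (ENNReal.div_ne_zero.2 ⟨hε2, hct⟩)
  -- The tail estimate is applied with `2t`, and `8 · 2t = (1-r)(1-ρ)`.
  set t : ℝ := (1 - r) * (1 - ρ) / 16 with ht
  have ht0 : 0 < t := by
    have h1 : 0 < 1 - r := by linarith
    have h2 : 0 < 1 - ρ := by linarith
    positivity
  set N : ℝ≥0∞ := (6 * S ^ (1 / p) * ENNReal.ofReal t⁻¹) ^ p * M ^ p with hN
  have hNt : N ≠ ∞ := ENNReal.mul_ne_top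
    (ENNReal.rpow_ne_top_of_nonneg hp0 (ENNReal.mul_ne_top (ENNReal.mul_ne_top (by simp)
      (ENNReal.rpow_ne_top_of_nonneg (by positivity) hSt)) ENNReal.ofReal_ne_top))
    (ENNReal.rpow_ne_top_of_nonneg hp0 ENNReal.ofReal_ne_top)
  obtain ⟨s, hs1, hs⟩ := exists_bmoaIntegral_selfMap_le hp1 hp2 hd hmaps hinj
    (ENNReal.div_ne_zero.2 ⟨hε2, hNt⟩)
  refine ⟨s, hs1, fun a ha has hψa => ?_⟩
  have hb := hmaps ha
  have hF := hf.1.comp (differentiableOn_mobius hb) (mapsTo_mobius hb)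
  have h1 := dirichletIntegral_comp_le_add hp1 hp2 hF (hS _ hb)
    (differentiableOn_recenter hd hmaps ha) (mapsTo_recenter hmaps ha)
    (injOn_recenter hmaps hinj ha) (recenter_zero ψ a) ht0
  have h2 := lintegral_annulus_comp_mobius_le hp0 hf.1 hb (r := r) (t := 2 * t) hρ hψa
    (by rw [ht]; linarith)
  have h3 : ENNReal.ofReal (1 / Real.pi) * dirichletIntegral p (recenter ψ a) ≤
      M ^ p * (ε / 2 / N) := by
    have h4 := bmoaIntegral_mobius_comp_le hp0 hd hmaps hb hρ hψa a
    rw [bmoaIntegral_eq_dirichletIntegral hp0 (f := mobius (ψ a) ∘ ψ)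
      ((differentiableOn_mobius hb).comp hd hmaps) ha] at h4
    exact h4.trans (mul_le_mul_right (hs a ha has) _)
  rw [bmoaIntegral_comp_eq hp0 hf.1 hd hmaps ha]
  calc _ ≤ ENNReal.ofReal (1 / Real.pi) * (1332 * (M * (ε / 2 / c)) +
        (6 * S ^ (1 / p) * ENNReal.ofReal t⁻¹) ^ p * dirichletIntegral p (recenter ψ a)) := by
        refine mul_le_mul_right (h1.trans ?_) _
        gcongr
        exact h2.trans (mul_le_mul_right hr _)
    _ = c * (ε / 2 / c) + (6 * S ^ (1 / p) * ENNReal.ofReal t⁻¹) ^ p *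
        (ENNReal.ofReal (1 / Real.pi) * dirichletIntegral p (recenter ψ a)) := by
        rw [hc]; ring
    _ ≤ c * (ε / 2 / c) + (6 * S ^ (1 / p) * ENNReal.ofReal t⁻¹) ^ p * (M ^ p * (ε / 2 / N)) := by
        gcongr
    _ = c * (ε / 2 / c) + N * (ε / 2 / N) := by rw [hN]; ring
    _ ≤ ε / 2 + ε / 2 := add_le_add ENNReal.mul_div_le ENNReal.mul_div_le
    _ = ε := ENNReal.add_halves ε

/-- The decay of `f` fixes `ρ` and handles `|ψ(a)| > ρ`; the points with `|ψ(a)| ≤ ρ` are handled by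
the decay of `I_p(ψ,a)`. No boundary behaviour of `ψ` is needed. -/
theorem mapsTo_compOp_VMOA {p : ℝ} (hp1 : 1 ≤ p) (hp2 : p ≤ 2) {ψ : ℂ → ℂ}
    (hd : DifferentiableOn ℂ ψ disc) (hmaps : Set.MapsTo ψ disc disc)
    (hinj : Set.InjOn ψ disc) : Set.MapsTo (compOp ψ) (VMOA p) (VMOA p) := fun f hf => by
  refine ⟨mapsTo_compOp_BMOA hp1 hp2 hd hmaps hinj hf.1,
    tendsto_comap_norm_zero_iff.2 fun ε hε => ?_⟩
  obtain ⟨ρ, hρ, hfρ⟩ := tendsto_comap_norm_zero_iff.1 hf.2 (ε / 1332)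
    (ENNReal.div_ne_zero.2 ⟨hε, by simp⟩)
  obtain ⟨s, hs, hsψ⟩ := exists_bmoaIntegral_comp_le hp1 hp2 hf.1 hd hmaps hinj hρ hε
  refine ⟨s, hs, fun a ha has => ?_⟩
  rcases le_or_gt ‖ψ a‖ ρ with h | h
  · exact hsψ a ha has h
  · calc _ ≤ 1332 * bmoaIntegral p f (ψ a) := bmoaIntegral_comp_le hp1 hp2 hf.1.1 hd hmaps hinj ha
      _ ≤ 1332 * (ε / 1332) := by gcongr; exact hfρ _ (hmaps ha) h
      _ ≤ ε := ENNReal.mul_div_le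

end CompBMOA

theorem mainTheorem6 (p : ℝ) (hp1 : 1 ≤ p) (hp2 : p < 2) :
    ∃ C : ℝ, 0 < C ∧
      ∀ ψ : ℂ → ℂ, DifferentiableOn ℂ ψ CompBMOA.disc →
        Set.MapsTo ψ CompBMOA.disc CompBMOA.disc → Set.InjOn ψ CompBMOA.disc →
        (Set.MapsTo (CompBMOA.compOp ψ) (CompBMOA.BMOA p) (CompBMOA.BMOA p) ∧
          CompBMOA.compOpNorm p (CompBMOA.BMOA p) ψ ≤
            ENNReal.ofReal (C * (1 + Real.log ((1 + ‖ψ 0‖) / (1 - ‖ψ 0‖))))) ∧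
        (Set.MapsTo (CompBMOA.compOp ψ) (CompBMOA.VMOA p) (CompBMOA.VMOA p) ∧
          CompBMOA.compOpNorm p (CompBMOA.VMOA p) ψ < ∞) :=
  ⟨1400, by norm_num, fun _ hd hmaps hinj =>
    ⟨⟨CompBMOA.mapsTo_compOp_BMOA hp1 hp2.le hd hmaps hinj,
      CompBMOA.compOpNorm_le_of_subset hp1 hp2.le hd hmaps hinj subset_rfl⟩,
    ⟨CompBMOA.mapsTo_compOp_VMOA hp1 hp2.le hd hmaps hinj,
      (CompBMOA.compOpNorm_le_of_subset hp1 hp2.le hd hmaps hinj fun _ hf => hf.1).trans_lt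
        ENNReal.ofReal_lt_top⟩⟩⟩
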